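/- **Setting.** Let $f:[N]\to\{0,1\}$ be given by a quantum oracle, let $K=\#\{x: f(x)=1\}$, and let $1/N\le\epsilon\le1$. For $a,b>0$ write $a\approx_{1+\eta}b$ if $\frac1{1+\eta}\le a/b\le1+\eta$. *Approximate Counting* asks for a number $\hat K$ with $\hat K\approx_{1+\epsilon}K$ with high probability. For an $f$ with domain of size $M$, flipping the *Grover coin* of order $q$ means: prepare the uniform superposition over $[M]$, apply $q$ Grover iterations (each one query to $f$ followed by the Grover diffusion), measure, and report whether the measured $x$ has $f(x)=1$; this happens with probability $\sin^2((2q+1)\theta^*)$, where $\theta^*=\arcsin\sqrt{K/M}$, and it costs $q+1$ queries. A *Grover schedule* consists of reals $r_1,\dots,r_m\ge1$ and positive integers $t_1,\dots,t_m$. Performing it means flipping, independently, for each $i$ the coin of order $q_i$ exactly $t_i$ times, where $2q_i+1$ is the largest odd integer not exceeding $r_i$, and recording the fraction $\hat p_i$ of heads, so that $\hat p_i\sim\frac1{t_i}\mathrm{Bin}(t_i,\sin^2((2q_i+1)\theta^*))$. It uses $\sum_i t_i(q_i+1)$ queries. A *nonadaptive Grover algorithm* performs one fixed schedule and then computes $\hat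 K$ from $(\hat p_1,\dots,\hat p_m)$ by classical post-processing. **Theorem 1.** There is a universal constant $C>0$ such that for all $N\ge1$, $\epsilon\in[1/N,1]$ and $\delta\in(0,1/2]$ the following holds. 1. There is a nonadaptive Grover algorithm (a Grover schedule and a post-processing depending only on $N,\epsilon,\delta$) that uses at most $C\sqrt{N/\epsilon}\,\log(1/\delta)$ queries and, for every $f:[N]\to\{0,1\}$ with $1\le K\le2^{-20}N$, outputs $\hat K$ with $\hat K\approx_{1+\epsilon}K$ with probability at least $1-\delta$. Its post-processing has small overhead: it is a deterministic decision tree, each step of which compares one $\hat p_i$ with a fixed threshold, with at most $C(\log N+1/\epsilon)$ steps. 2. There is also a nonadaptive Grover algorithm with the same bounds on queries and steps and the same guarantee for every $f:[N]\to\{0,1\}$ with $1\le K\le N/2$, where the schedule is performed on the extension of $f$ by $0$ to a domain of size $2^{20}N$. Thus, for constant success probability, the query complexity is $O(\sqrt{N/\epsilon})$. This is tight for nonadaptive Grover algorithms: 3. There are universal constants $c>0$ and $N_0$ such that for all $N\ge N_0$, all $\epsilon\in[1/N,1]$ and all $M\ge N$, every nonadaptive Grover algorithm, with arbitrary, possibly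 randomized, post-processing, performed on the extension of $f$ by $0$ to a domain of size $M$, that outputs $\hat K\approx_{1+\epsilon}K$ with probability at least $2/3$ for every $f:[N]\to\{0,1\}$ with $1\le K\le 2^{-20}N$, uses at least $c\sqrt{N/\epsilon}$ queries. -/

import Mathlib

open MeasureTheory ProbabilityTheory

noncomputable section

namespace NonadaptiveGrover

/-- `a ≈_{1+η} b` for positive reals `a`, `b`. -/
def Approx (η a b : ℝ) : Prop :=
  0 < a ∧ 0 < b ∧ 1 / (1 + η) ≤ a / b ∧ a / b ≤ 1 + η

/-- The number `K` of marked inputs of `f : [M] → {0,1}`. -/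
def numMarked {M : ℕ} (f : Fin M → Bool) : ℕ :=
  (Finset.univ.filter fun x => f x = true).card

/-- The extension of `f : [N] → {0,1}` by `0` to a domain `[M]`, `N ≤ M`. One query to it costs one
query to `f`. -/
def pad {N : ℕ} (M : ℕ) (f : Fin N → Bool) : Fin M → Bool :=
  fun x => if h : (x : ℕ) < N then f ⟨x, h⟩ else false

/-! ### Grover iterations on `ℂ^M` -/

/-- The uniform superposition `|s⟩`. -/
def uniformState (M : ℕ) : Fin M → ℂ := fun _ => ((1 / Real.sqrt M : ℝ) : ℂ)

/-- One (phase) query to `f`: `|x⟩ ↦ (-1)^{f(x)} |x⟩`. -/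
def oracle {M : ℕ} (f : Fin M → Bool) (ψ : Fin M → ℂ) : Fin M → ℂ :=
  fun x => if f x = true then -ψ x else ψ x

/-- The Grover diffusion `2|s⟩⟨s| - I`. -/
def diffusion {M : ℕ} (ψ : Fin M → ℂ) : Fin M → ℂ :=
  fun x => 2 * (∑ y, star (uniformState M y) * ψ y) * uniformState M x - ψ x

/-- A Grover iteration: one query followed by the diffusion. -/
def groverIteration {M : ℕ} (f : Fin M → Bool) (ψ : Fin M → ℂ) : Fin M → ℂ :=
  diffusion (oracle f ψ)

/-- The probability that measuring the state obtained from `|s⟩` by `q` Grover iterations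
yields a marked `x`. -/
def groverProb {M : ℕ} (f : Fin M → Bool) (q : ℕ) : ℝ :=
  ∑ x ∈ Finset.univ.filter (fun x => f x = true), ‖((groverIteration f)^[q] (uniformState M)) x‖ ^ 2

/-- The Grover angle `θ* = arcsin √(K/M)`. -/
def groverAngle {M : ℕ} (f : Fin M → Bool) : ℝ :=
  Real.arcsin (Real.sqrt ((numMarked f : ℝ) / M))

lemma numMarked_le {M : ℕ} (f : Fin M → Bool) : numMarked f ≤ M := by
  simpa [numMarked] using Finset.card_le_univ (Finset.univ.filter fun x => f x = true)

lemma sin_groverAngle {M : ℕ} (f : Fin M → Bool) :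
    Real.sin (groverAngle f) = Real.sqrt ((numMarked f : ℝ) / M) := by
  have h : ((numMarked f : ℝ) / M) ≤ 1 :=
    div_le_one_of_le₀ (by exact_mod_cast numMarked_le f) (by positivity)
  exact Real.sin_arcsin (by linarith [Real.sqrt_nonneg ((numMarked f : ℝ) / M)])
    (Real.sqrt_le_one.mpr h)

lemma cos_groverAngle {M : ℕ} (f : Fin M → Bool) :
    Real.cos (groverAngle f) = Real.sqrt (1 - (numMarked f : ℝ) / M) := by
  rw [groverAngle, Real.cos_arcsin, Real.sq_sqrt (by positivity)]

/-- The state after `q` Grover iterations. -/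
lemma groverState_eq {M : ℕ} (f : Fin M → Bool) (q : ℕ) :
    (groverIteration f)^[q] (uniformState M) = fun x =>
      (((if f x = true then Real.sin ((2 * q + 1) * groverAngle f) / Real.sqrt (numMarked f)
        else Real.cos ((2 * q + 1) * groverAngle f) / Real.sqrt (M - numMarked f)) : ℝ) : ℂ) := by
  rcases Nat.eq_zero_or_pos M with rfl | hM
  · funext x
    exact x.elim0
  have hM0 : (0 : ℝ) < M := by exact_mod_cast hM
  have hs : Real.sqrt M ≠ 0 := (Real.sqrt_pos.mpr hM0).ne'
  have hss : Real.sqrt M * Real.sqrt M = M := Real.mul_self_sqrt hM0.le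
  have hKM : (numMarked f : ℝ) ≤ M := by exact_mod_cast numMarked_le f
  have h1 : Real.sqrt (numMarked f) = Real.sqrt M * Real.sin (groverAngle f) := by
    rw [sin_groverAngle, ← Real.sqrt_mul hM0.le, mul_div_cancel₀ _ hM0.ne']
  have h2 : Real.sqrt (M - numMarked f) = Real.sqrt M * Real.cos (groverAngle f) := by
    rw [cos_groverAngle, ← Real.sqrt_mul hM0.le, mul_sub, mul_div_cancel₀ _ hM0.ne', mul_one]
  have hpos : ∀ x, f x = true → Real.sin (groverAngle f) ≠ 0 := by
    intro x hx h0
    have hc : 0 < numMarked f := Finset.card_pos.mpr ⟨x, by simp [hx]⟩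
    have : 0 < Real.sqrt (numMarked f) := Real.sqrt_pos.mpr (by exact_mod_cast hc)
    rw [h1, h0, mul_zero] at this
    exact this.false
  have hpos' : ∀ x, ¬ f x = true → Real.cos (groverAngle f) ≠ 0 := by
    intro x hx h0
    have hc : numMarked f < M := by
      have : numMarked f < (Finset.univ : Finset (Fin M)).card :=
        Finset.card_lt_card (Finset.filter_ssubset.mpr ⟨x, Finset.mem_univ _, hx⟩)
      simpa using this
    have hc' : (numMarked f : ℝ) < M := by exact_mod_cast hc
    have : 0 < Real.sqrt (M - numMarked f) := Real.sqrt_pos.mpr (by linarith)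
    rw [h2, h0, mul_zero] at this
    exact this.false
  have hKs : ∀ a : ℝ, (numMarked f : ℝ) * (a / Real.sqrt (numMarked f))
      = Real.sqrt (numMarked f) * a := by
    intro a
    rw [mul_div_assoc', mul_comm, mul_div_assoc, Real.div_sqrt, mul_comm]
  have hKs' : ∀ a : ℝ, ((M : ℝ) - numMarked f) * (a / Real.sqrt (M - numMarked f))
      = Real.sqrt (M - numMarked f) * a := by
    intro a
    rw [mul_div_assoc', mul_comm, mul_div_assoc, Real.div_sqrt, mul_comm]
  have hcard : ((Finset.univ.filter fun x => ¬ f x = true).card : ℝ) = M - numMarked f := by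
    have := Finset.card_filter_add_card_filter_not (s := (Finset.univ : Finset (Fin M)))
      (fun x => f x = true)
    rw [Finset.card_univ, Fintype.card_fin] at this
    have h3 : (numMarked f : ℝ) + ((Finset.univ.filter fun x => ¬ f x = true).card : ℝ) = M := by
      exact_mod_cast this
    linarith
  induction q with
  | zero =>
    funext x
    simp only [Function.iterate_zero, id, uniformState, Nat.cast_zero, mul_zero, zero_add, one_mul]
    congr 1
    split_ifs with hx
    · have := hpos x hx
      rw [h1]
      field_simp
    · have := hpos' x hx
      rw [h2]
      field_simp
  | succ q ih =>
    rw [Function.iterate_succ_apply', ih]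
    set φ := (2 * (q : ℝ) + 1) * groverAngle f with hφ
    have hφ' : (2 * ((q + 1 : ℕ) : ℝ) + 1) * groverAngle f = φ + 2 * groverAngle f := by
      rw [hφ]; push_cast; ring
    rw [hφ']
    funext x
    have hsum : ∑ y, (if f y = true then -(Real.sin φ / Real.sqrt (numMarked f))
        else Real.cos φ / Real.sqrt (M - numMarked f))
        = Real.sqrt M * Real.cos (φ + groverAngle f) := by
      rw [Finset.sum_ite, Finset.sum_const, Finset.sum_const, nsmul_eq_mul, nsmul_eq_mul, hcard,
        hKs', ← numMarked, mul_neg, hKs, h1, h2, Real.cos_add]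
      ring
    have hgo : groverIteration f (fun x =>
        (((if f x = true then Real.sin φ / Real.sqrt (numMarked f)
          else Real.cos φ / Real.sqrt (M - numMarked f)) : ℝ) : ℂ)) x =
        ((2 * (1 / Real.sqrt M * (Real.sqrt M * Real.cos (φ + groverAngle f))) * (1 / Real.sqrt M)
          - (if f x = true then -(Real.sin φ / Real.sqrt (numMarked f))
        else Real.cos φ / Real.sqrt (M - numMarked f)) : ℝ) : ℂ) := by
      have e : oracle f (fun x =>
        (((if f x = true then Real.sin φ / Real.sqrt (numMarked f)
          else Real.cos φ / Real.sqrt (M - numMarked f)) : ℝ) : ℂ)) = fun y =>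
          ((if f y = true then -(Real.sin φ / Real.sqrt (numMarked f))
        else Real.cos φ / Real.sqrt (M - numMarked f) : ℝ) : ℂ) := by
        funext y
        by_cases hy : f y = true <;> simp [oracle, hy]
      rw [groverIteration, e, ← hsum]
      simp only [diffusion, uniformState, ← Finset.mul_sum]
      rw [← starRingEnd_apply, Complex.conj_ofReal]
      push_cast
      ring
    rw [hgo]
    congr 1
    have hcs := Real.sin_sq_add_cos_sq (groverAngle f)
    split_ifs with hx
    · have := hpos x hx
      rw [h1]
      field_simp
      rw [Real.cos_add, Real.sin_add, Real.sin_two_mul, Real.cos_two_mul]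
      linear_combination (-2 * Real.sin φ) * hcs
    · have := hpos' x hx
      rw [h2]
      field_simp
      rw [Real.cos_add, Real.cos_add, Real.sin_two_mul, Real.cos_two_mul]
      ring

/-- The coin flipped with `q` Grover iterations has bias `sin² ((2q+1) θ*)`. -/
theorem groverProb_eq {M : ℕ} (f : Fin M → Bool) (q : ℕ) :
    groverProb f q = Real.sin ((2 * q + 1) * groverAngle f) ^ 2 := by
  have h : groverProb f q = (numMarked f : ℝ) *
      (Real.sin ((2 * q + 1) * groverAngle f) / Real.sqrt (numMarked f)) ^ 2 := by
    rw [groverProb, groverState_eq, ← nsmul_eq_mul]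
    refine Finset.sum_eq_card_nsmul fun x hx => ?_
    beta_reduce
    rw [if_pos (Finset.mem_filter.mp hx).2, Complex.norm_real, Real.norm_eq_abs, sq_abs]
  rw [h, div_pow, Real.sq_sqrt (Nat.cast_nonneg _)]
  rcases Nat.eq_zero_or_pos (numMarked f) with h0 | h0
  · simp [groverAngle, h0]
  · have : (numMarked f : ℝ) ≠ 0 := by exact_mod_cast h0.ne'
    field_simp

lemma groverProb_mem {M : ℕ} (f : Fin M → Bool) (q : ℕ) : groverProb f q ∈ unitInterval := by
  rw [groverProb_eq]
  exact ⟨sq_nonneg _, Real.sin_sq_le_one _⟩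

/-! ### Grover schedules -/

/-- The number `q` of Grover iterations with `2q + 1` the largest odd integer not exceeding `r`
(for `r ≥ 1`). -/
def groverIters (r : ℝ) : ℕ := ⌊(r - 1) / 2⌋₊

lemma isGreatest_groverIters {r : ℝ} (hr : 1 ≤ r) :
    IsGreatest {n : ℕ | Odd n ∧ (n : ℝ) ≤ r} (2 * groverIters r + 1) := by
  constructor
  · refine ⟨⟨_, rfl⟩, ?_⟩
    have := Nat.floor_le (show 0 ≤ (r - 1) / 2 by linarith)
    push_cast [groverIters]
    linarith
  · rintro n ⟨⟨k, rfl⟩, hk⟩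
    have : k ≤ groverIters r := Nat.le_floor (by push_cast at hk; linarith)
    omega

/-- A Grover schedule: `R = (r_1, …, r_m)` and `T = (t_1, …, t_m)`. -/
structure GroverSchedule where
  m : ℕ
  r : Fin m → ℝ
  t : Fin m → ℕ
  one_le_r : ∀ i, 1 ≤ r i
  t_pos : ∀ i, 0 < t i

/-- The number of queries: each of the `t_i` flips of the `i`-th coin uses one query per Grover
iteration and one more query to evaluate `f` at the measured `x`. -/
def GroverSchedule.queries (S : GroverSchedule) : ℕ :=
  ∑ i, S.t i * (groverIters (S.r i) + 1)

/-- The joint law of the numbers of heads when the schedule is performed on `f`: independent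
binomial variables, the `i`-th one counting the marked outcomes among `t_i` runs. -/
def GroverSchedule.law (S : GroverSchedule) {M : ℕ} (f : Fin M → Bool) :
    Measure (Fin S.m → ℕ) :=
  Measure.pi fun i =>
    ProbabilityTheory.binomial (S.t i)
      ⟨groverProb f (groverIters (S.r i)), groverProb_mem f (groverIters (S.r i))⟩

/-- The observed averages `p̂_i` of the coin flips. -/
def GroverSchedule.estimates (S : GroverSchedule) (k : Fin S.m → ℕ) : Fin S.m → ℝ :=
  fun i => (k i : ℝ) / S.t i

/-- The probability that performing `S` on `f` and then applying the classical post-processing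
`g` outputs some `K̂ ≈_{1+ε} K`. -/
def GroverSchedule.successProb (S : GroverSchedule) (g : (Fin S.m → ℝ) → ℝ) (ε : ℝ)
    {M : ℕ} (f : Fin M → Bool) : ℝ :=
  (S.law f).real {k | Approx ε (g (S.estimates k)) (numMarked f)}

/-- The same probability for a randomized post-processing, which outputs `K̂` distributed as
`g p̂`. -/
def GroverSchedule.successProbRand (S : GroverSchedule)
    (g : (Fin S.m → ℝ) → ProbabilityMeasure ℝ) (ε : ℝ) {M : ℕ} (f : Fin M → Bool) : ℝ :=
  ∫ k, (g (S.estimates k) : Measure ℝ).real {x | Approx ε x (numMarked f)} ∂(S.law f)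

/-- A deterministic classical post-processing of `m` observed averages, as a decision tree: a step
compares one average with a threshold. -/
inductive PostProcessing (m : ℕ) : Type
  | output (x : ℝ) : PostProcessing m
  | compare (i : Fin m) (threshold : ℝ) (below notBelow : PostProcessing m) : PostProcessing m

open Classical in
/-- The output `K̂`. -/
def PostProcessing.run {m : ℕ} : PostProcessing m → (Fin m → ℝ) → ℝ
  | .output x, _ => x
  | .compare i a below notBelow, p => if p i < a then below.run p else notBelow.run p

/-- The worst-case number of steps. -/
def PostProcessing.steps {m : ℕ} : PostProcessing m → ℕ
  | .output _ => 0
  | .compare _ _ below notBelow => max below.steps notBelow.steps + 1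

end NonadaptiveGrover

end

open NonadaptiveGrover

/-! Upper bound. Write `K = N sin² θ`. At scale `s ≈ 2^j` the coin with `2q + 1 = s` has bias `sin²
(sθ)`. Scanning the scales upwards, the first coin showing heads at a rate of at least `1/8`
certifies `1/4 ≤ sθ ≤ 3/2` (`exists_scanTree`). The angle then lies in an interval of length
`5/(4s)`, which is shortened by the factor `3/4` again and again. For an interval of centre `c` and
length `w`, a coin with `2q + 1 = r`, `rw ≈ 1` and `cos (2rc) ≈ 0` is steep and monotone across the
interval, so comparing its average with `sin² (rc)` excludes one outer quarter (`sin_sq_separation`,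
`exists_refineTree`).

The ideal `r` depends on `c`, that is, on earlier outcomes. Nonadaptivity is recovered because `320`
orders, depending only on `s` and `w`, contain a good one for every possible `c`
(`exists_refineOrder`). All of them are flipped in advance for every scale and length; the tree
reads only the ones it needs.

The angle is needed up to `ρ = max (ε/(300s), s/(8N))`: the first term gives relative error `ε`,
while with the second `K` is known to within `1/2` and can be rounded (`approx_leafOutput`). Flip
counts grow linearly as the orders decrease geometrically, so scale `s` costs `O(1/ρ)` and the
failure probabilities still sum geometrically. Since `1/ρ` is of order `min (s/ε, N/s)`, the sum
over dyadic `s` is dominated by `s ≈ √(Nε)` and is `O(√(N/ε))` (`sum_inv_precision_le`).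

Lower bound. A flip costing `q + 1` queries changes its bias by at most `(2q + 1)|Δθ|` between two
inputs, so all outcome probabilities change by at most `2 · queries · |Δθ|`
(`GroverSchedule.abs_integral_law_sub_le`). For `K ≈ 1/ε` the counts `K` and `K + 7` must be told
apart, yet their angles differ by only `O(√(ε/N))`. -/

open MeasureTheory ProbabilityTheory

noncomputable section

namespace NonadaptiveGrover

/-! ### Binomial and product measures -/

/-- The expectation of `f` under the binomial law, as a finite sum. -/
def binomialMean (t : ℕ) (p : ℝ) (f : ℕ → ℝ) : ℝ :=
  ∑ k ∈ Finset.range (t + 1), (t.choose k * p ^ k * (1 - p) ^ (t - k)) * f k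

lemma integral_binomial_eq_mean (t : ℕ) (p : unitInterval) (f : ℕ → ℝ) :
    ∫ k, f k ∂(binomial t p) = binomialMean t p f := by
  rw [integral_binomial, binomialMean]
  refine Finset.sum_congr ?_ fun _ _ => by rw [smul_eq_mul]
  ext k
  simp

/-- Conditioning on one flip; this recursion replaces couplings in the inductions below. -/
lemma binomialMean_succ (t : ℕ) (p : ℝ) (f : ℕ → ℝ) :
    binomialMean (t + 1) p f =
      p * binomialMean t p (fun k => f (k + 1)) + (1 - p) * binomialMean t p f := by
  have h : binomialMean t p f = ∑ k ∈ Finset.range (t + 1 + 1),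
      (t.choose k * p ^ k * (1 - p) ^ (t - k)) * f k := by
    rw [Finset.sum_range_succ, Nat.choose_succ_self, binomialMean]
    simp
  rw [h, Finset.sum_range_succ', binomialMean, Finset.sum_range_succ', binomialMean,
    mul_add, Finset.mul_sum, Finset.mul_sum, ← add_assoc, ← Finset.sum_add_distrib]
  congr 1
  · refine Finset.sum_congr rfl fun k hk => ?_
    rw [Nat.choose_succ_succ', Nat.add_sub_add_right]
    rcases (Nat.lt_succ_iff.mp (Finset.mem_range.mp hk)).eq_or_lt with rfl | hlt
    · simp
      ring
    · obtain ⟨d, rfl⟩ := Nat.exists_eq_add_of_lt hlt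
      have e1 : k + d + 1 - k = d + 1 := by omega
      have e2 : k + d + 1 - (k + 1) = d := by omega
      rw [e1, e2]
      push_cast
      ring
  · simp
    ring

lemma binomialMean_mem {t : ℕ} {p : ℝ} (h0 : 0 ≤ p) (h1 : p ≤ 1) {f : ℕ → ℝ}
    (hf : ∀ k, f k ∈ Set.Icc (0 : ℝ) 1) : binomialMean t p f ∈ Set.Icc (0 : ℝ) 1 := by
  induction t generalizing f with
  | zero => simpa [binomialMean] using hf 0
  | succ t ih =>
    rw [binomialMean_succ]
    exact convex_Icc (0 : ℝ) 1 (ih fun k => hf (k + 1)) (ih hf) h0 (by linarith) (by ring)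

/-- Each of the `t` flips contributes at most the total variation distance `|p - p'|` of two coins.
-/
lemma abs_binomialMean_sub_le {t : ℕ} {p p' : ℝ} (h0 : 0 ≤ p) (h1 : p ≤ 1) (h0' : 0 ≤ p')
    (h1' : p' ≤ 1) {f : ℕ → ℝ} (hf : ∀ k, f k ∈ Set.Icc (0 : ℝ) 1) :
    |binomialMean t p f - binomialMean t p' f| ≤ t * |p - p'| := by
  induction t generalizing f with
  | zero => simp [binomialMean]
  | succ t ih =>
    rw [binomialMean_succ, binomialMean_succ]
    have i1 := ih fun k => hf (k + 1)
    have i0 := ih hf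
    have m1 := binomialMean_mem (t := t) h0' h1' fun k => hf (k + 1)
    have m0 := binomialMean_mem (t := t) h0' h1' hf
    set a := binomialMean t p fun k => f (k + 1)
    set b := binomialMean t p f
    set a' := binomialMean t p' fun k => f (k + 1)
    set b' := binomialMean t p' f
    have e : p * a + (1 - p) * b - (p' * a' + (1 - p') * b')
        = p * (a - a') + (1 - p) * (b - b') + (p - p') * (a' - b') := by ring
    have h2 : |a' - b'| ≤ 1 := by
      rw [abs_le]; constructor <;> linarith [m1.1, m1.2, m0.1, m0.2]
    rw [e]
    calc _ ≤ |p * (a - a')| + |(1 - p) * (b - b')| + |(p - p') * (a' - b')| := abs_add_three _ _ _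
      _ = p * |a - a'| + (1 - p) * |b - b'| + |p - p'| * |a' - b'| := by
        rw [abs_mul, abs_mul, abs_mul, abs_of_nonneg h0, abs_of_nonneg (sub_nonneg.mpr h1)]
      _ ≤ p * (t * |p - p'|) + (1 - p) * (t * |p - p'|) + |p - p'| * 1 := by
        have := sub_nonneg.mpr h1
        gcongr
      _ = ((t + 1 : ℕ) : ℝ) * |p - p'| := by push_cast; ring

/-- A hybrid argument: expectations of `[0,1]`-valued functions under two product measures differ
by at most the sum of the differences of the factors. -/
lemma abs_integral_pi_sub_le {m : ℕ} (μ ν : Fin m → Measure ℕ) [∀ i, IsProbabilityMeasure (μ i)]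
    [∀ i, IsProbabilityMeasure (ν i)] (d : Fin m → ℝ)
    (hd : ∀ i (f : ℕ → ℝ), (∀ k, f k ∈ Set.Icc (0 : ℝ) 1) →
      |∫ k, f k ∂(μ i) - ∫ k, f k ∂(ν i)| ≤ d i)
    (F : (Fin m → ℕ) → ℝ) (hF : ∀ k, F k ∈ Set.Icc (0 : ℝ) 1) :
    |∫ k, F k ∂(Measure.pi μ) - ∫ k, F k ∂(Measure.pi ν)| ≤ ∑ i, d i := by
  induction m with
  | zero =>
    have : Measure.pi μ = Measure.pi ν := by
      congr 1; funext i; exact i.elim0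
    simp [this]
  | succ m ih =>
    have key : ∀ (κ : Fin (m + 1) → Measure ℕ) [∀ i, IsProbabilityMeasure (κ i)],
        ∫ k, F k ∂(Measure.pi κ) =
          ∫ a, ∫ b, F (Fin.cons a b) ∂(Measure.pi fun i : Fin m => κ i.succ) ∂(κ 0) := by
      intro κ _
      have hp := measurePreserving_piFinSuccAbove κ 0
      have h := hp.symm.integral_comp (MeasurableEquiv.measurableEmbedding _) F
      rw [← h, integral_prod]
      · have e : ∀ (a : ℕ) (b : Fin m → ℕ),
            (MeasurableEquiv.piFinSuccAbove (fun _ : Fin (m + 1) => ℕ) 0).symm (a, b)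
              = Fin.cons a b := fun a b => Fin.insertNth_zero' a b
        simp only [e, Fin.zero_succAbove]
      · refine Integrable.of_bound (C := 1) Measurable.of_discrete.aestronglyMeasurable
          (Filter.Eventually.of_forall fun x => ?_)
        rw [Real.norm_eq_abs, abs_le]
        have := hF ((MeasurableEquiv.piFinSuccAbove (fun _ => ℕ) 0).symm x)
        exact ⟨by linarith [this.1], this.2⟩
    have bd : ∀ (κ : Fin m → Measure ℕ) [∀ i, IsProbabilityMeasure (κ i)] (a : ℕ),
        ∫ b, F (Fin.cons a b) ∂(Measure.pi κ) ∈ Set.Icc (0 : ℝ) 1 := by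
      intro κ _ a
      refine ⟨integral_nonneg fun b => (hF _).1, ?_⟩
      calc _ ≤ ∫ _, (1 : ℝ) ∂(Measure.pi κ) := by
            refine integral_mono_of_nonneg (Filter.Eventually.of_forall fun b => (hF _).1)
              (integrable_const _) (Filter.Eventually.of_forall fun b => (hF _).2)
        _ = 1 := by simp
    rw [key μ, key ν, Fin.sum_univ_succ]
    have hint : ∀ (f : ℕ → ℝ) (κ : Measure ℕ) [IsProbabilityMeasure κ],
        (∀ k, f k ∈ Set.Icc (0 : ℝ) 1) → Integrable f κ := by
      intro f κ _ hf
      refine Integrable.of_bound (C := 1) Measurable.of_discrete.aestronglyMeasurable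
        (Filter.Eventually.of_forall fun x => ?_)
      rw [Real.norm_eq_abs, abs_le]
      exact ⟨by linarith [(hf x).1], (hf x).2⟩
    have h1 := hd 0 _ fun a => bd (fun i => μ i.succ) a
    have h2 : |∫ a, ∫ b, F (Fin.cons a b) ∂(Measure.pi fun i : Fin m => μ i.succ) ∂(ν 0)
        - ∫ a, ∫ b, F (Fin.cons a b) ∂(Measure.pi fun i : Fin m => ν i.succ) ∂(ν 0)|
        ≤ ∑ i : Fin m, d i.succ := by
      rw [← integral_sub (hint _ _ fun a => bd _ a) (hint _ _ fun a => bd _ a),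
        ← Real.norm_eq_abs]
      refine le_trans (b := (∑ i : Fin m, d i.succ) * (ν 0).real Set.univ)
        (norm_integral_le_of_norm_le_const (Filter.Eventually.of_forall fun a => ?_))
        (by rw [probReal_univ, mul_one])
      exact ih (fun i => μ i.succ) (fun i => ν i.succ) (fun i => d i.succ)
        (fun i => hd i.succ) _ fun b => hF _
    -- The hybrid law has its first factor taken from `ν` and the others from `μ`.
    calc _ ≤ _ := abs_sub_le _ (∫ a, ∫ b, F (Fin.cons a b)
              ∂(Measure.pi fun i : Fin m => μ i.succ) ∂(ν 0)) _
      _ ≤ _ := add_le_add h1 h2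

lemma binomialMean_exp_le {t : ℕ} {p l : ℝ} (h0 : 0 ≤ p) (h1 : p ≤ 1) (hl : |l| ≤ 1) :
    binomialMean t p (fun k => Real.exp (l * k)) ≤ Real.exp (t * (p * l + l ^ 2)) := by
  have e : binomialMean t p (fun k => Real.exp (l * k)) = (p * Real.exp l + (1 - p)) ^ t := by
    rw [add_pow, binomialMean]
    refine Finset.sum_congr rfl fun k _ => ?_
    rw [mul_pow, ← Real.exp_nat_mul, mul_comm l]
    ring
  have h2 : Real.exp l ≤ 1 + l + l ^ 2 := by
    have := Real.abs_exp_sub_one_sub_id_le hl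
    linarith [abs_le.mp this]
  rw [e, Real.exp_nat_mul]
  have h3 : 0 ≤ p * Real.exp l + (1 - p) := by positivity [Real.exp_pos l, sub_nonneg.mpr h1]
  refine pow_le_pow_left₀ h3 ?_ t
  have := Real.add_one_le_exp (p * l + l ^ 2)
  nlinarith [mul_le_mul_of_nonneg_left h2 h0, mul_le_mul_of_nonneg_right h1 (sq_nonneg l)]

/-- Markov's inequality for `exp (l k)`; the sign of `l` selects the upper or the lower tail. -/
lemma binomial_tail_le {t : ℕ} {p : unitInterval} {η l : ℝ} (hl : |l| ≤ 1) :
    (binomial t p).real {k : ℕ | t * (l * p + l ^ 2 + η) ≤ l * k} ≤ Real.exp (-(t * η)) := by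
  have hm := mul_meas_ge_le_integral_of_nonneg (μ := binomial t p)
    (f := fun k : ℕ => Real.exp (l * k)) (Filter.Eventually.of_forall fun k => (Real.exp_pos _).le)
    (integrable_binomial _) (Real.exp (t * (l * p + l ^ 2 + η)))
  rw [integral_binomial_eq_mean] at hm
  have h2 := hm.trans (binomialMean_exp_le p.2.1 p.2.2 hl)
  simp only [Real.exp_le_exp] at h2
  rw [← le_div_iff₀' (Real.exp_pos _), ← Real.exp_sub] at h2
  refine h2.trans (le_of_eq ?_)
  congr 1
  ring

/-- A Chernoff bound for the binomial law. -/
lemma binomial_concentration {t : ℕ} (ht : 0 < t) (p : unitInterval) {η : ℝ} (h0 : 0 ≤ η)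
    (h1 : η ≤ 1) :
    (binomial t p).real {k : ℕ | η ≤ |(k : ℝ) / t - p|} ≤ 2 * Real.exp (-(t * (η ^ 2 / 4))) := by
  have ht' : (0 : ℝ) < t := by exact_mod_cast ht
  have a := binomial_tail_le (t := t) (p := p) (η := η ^ 2 / 4) (l := η / 2)
    (by rw [abs_of_nonneg] <;> linarith)
  have b := binomial_tail_le (t := t) (p := p) (η := η ^ 2 / 4) (l := -(η / 2))
    (by rw [abs_neg, abs_of_nonneg] <;> linarith)
  have hsub : {k : ℕ | η ≤ |(k : ℝ) / t - p|} ⊆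
      {k : ℕ | t * (η / 2 * p + (η / 2) ^ 2 + η ^ 2 / 4) ≤ η / 2 * k} ∪
      {k : ℕ | t * (-(η / 2) * p + (-(η / 2)) ^ 2 + η ^ 2 / 4) ≤ -(η / 2) * k} := by
    intro k hk
    have hk' : η ≤ |(k : ℝ) / t - p| := hk
    have e : (k : ℝ) = t * (k / t) := by field_simp
    rcases le_abs.mp hk' with h | h
    · left
      rw [Set.mem_ofPred_eq]
      rw [e]
      nlinarith [mul_le_mul_of_nonneg_left h (mul_nonneg ht'.le h0)]
    · right
      rw [Set.mem_ofPred_eq]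
      rw [e]
      nlinarith [mul_le_mul_of_nonneg_left h (mul_nonneg ht'.le h0)]
  calc _ ≤ _ := measureReal_mono hsub
    _ ≤ _ := measureReal_union_le _ _
    _ ≤ _ := add_le_add a b
    _ = _ := by ring

/-! ### Functions with a given number of marked inputs -/

lemma numMarked_pad {N M : ℕ} (h : N ≤ M) (f : Fin N → Bool) :
    numMarked (pad M f) = numMarked f := by
  rw [numMarked, numMarked, ← Finset.card_map (Fin.castLEEmb h)]
  congr 1
  ext x
  simp only [Finset.mem_filter, Finset.mem_univ, true_and, Finset.mem_map]
  constructor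
  · intro hx
    by_cases hlt : (x : ℕ) < N
    · exact ⟨⟨x, hlt⟩, by simpa [pad, hlt] using hx, rfl⟩
    · simp [pad, hlt] at hx
  · rintro ⟨y, hy, rfl⟩
    simpa [pad] using hy

lemma exists_numMarked_eq {N K : ℕ} (h : K ≤ N) : ∃ f : Fin N → Bool, numMarked f = K := by
  refine ⟨fun x => decide ((x : ℕ) < K), ?_⟩
  have e : (Finset.univ.filter fun x : Fin N => decide ((x : ℕ) < K) = true)
      = Finset.univ.map (Fin.castLEEmb h) := by
    ext x
    simp only [Finset.mem_filter, Finset.mem_univ, true_and, Finset.mem_map, decide_eq_true_eq]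
    constructor
    · intro hx
      exact ⟨⟨x, hx⟩, rfl⟩
    · rintro ⟨y, rfl⟩
      exact y.2
  rw [numMarked, e, Finset.card_map, Finset.card_univ, Fintype.card_fin]

/-! ### The lower bound -/

lemma sin_sq_sub_sin_sq (a b : ℝ) :
    Real.sin a ^ 2 - Real.sin b ^ 2 = Real.sin (a - b) * Real.sin (a + b) := by
  rw [Real.sin_sub, Real.sin_add]
  have ha := Real.sin_sq_add_cos_sq a
  have hb := Real.sin_sq_add_cos_sq b
  linear_combination (-Real.sin a ^ 2) * hb + (Real.sin b ^ 2) * ha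

lemma abs_sin_sq_sub_le (a b : ℝ) : |Real.sin a ^ 2 - Real.sin b ^ 2| ≤ |a - b| := by
  rw [sin_sq_sub_sin_sq, abs_mul]
  calc _ ≤ |a - b| * 1 := mul_le_mul Real.abs_sin_le_abs (Real.abs_sin_le_one _)
        (abs_nonneg _) (abs_nonneg _)
    _ = _ := mul_one _

instance (S : GroverSchedule) {M : ℕ} (f : Fin M → Bool) : IsProbabilityMeasure (S.law f) := by
  rw [GroverSchedule.law]; infer_instance

lemma GroverSchedule.abs_integral_law_sub_le (S : GroverSchedule) {M M' : ℕ} (f : Fin M → Bool)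
    (f' : Fin M' → Bool) (F : (Fin S.m → ℕ) → ℝ) (hF : ∀ k, F k ∈ Set.Icc (0 : ℝ) 1) :
    |∫ k, F k ∂(S.law f) - ∫ k, F k ∂(S.law f')| ≤
      2 * S.queries * |groverAngle f - groverAngle f'| := by
  refine (abs_integral_pi_sub_le _ _ (fun i => S.t i * |groverProb f (groverIters (S.r i))
    - groverProb f' (groverIters (S.r i))|) (fun i G hG => ?_) F hF).trans ?_
  · rw [integral_binomial_eq_mean, integral_binomial_eq_mean]
    exact abs_binomialMean_sub_le (groverProb_mem _ _).1 (groverProb_mem _ _).2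
      (groverProb_mem _ _).1 (groverProb_mem _ _).2 hG
  · rw [GroverSchedule.queries, Nat.cast_sum, Finset.mul_sum, Finset.sum_mul]
    refine Finset.sum_le_sum fun i _ => ?_
    rw [groverProb_eq, groverProb_eq]
    set q := groverIters (S.r i)
    have h1 := abs_sin_sq_sub_le ((2 * q + 1) * groverAngle f) ((2 * q + 1) * groverAngle f')
    rw [← mul_sub, abs_mul, abs_of_nonneg (by positivity : (0 : ℝ) ≤ 2 * q + 1)] at h1
    have h2 : (2 * (q : ℝ) + 1) * |groverAngle f - groverAngle f'|
        ≤ (2 * (q + 1)) * |groverAngle f - groverAngle f'| := by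
      gcongr; linarith
    calc _ ≤ (S.t i : ℝ) * ((2 * (q + 1)) * |groverAngle f - groverAngle f'|) := by
          gcongr; exact h1.trans h2
      _ = _ := by push_cast; ring

lemma not_approx_of_lt {ε x a b : ℝ} (hε : 0 < ε) (hab : (1 + ε) ^ 2 * a < b)
    (ha : Approx ε x a) : ¬ Approx ε x b := by
  rintro ⟨_, hb0, hb, -⟩
  obtain ⟨_, ha0, -, ha⟩ := ha
  rw [div_le_iff₀ ha0] at ha
  rw [div_le_div_iff₀ (by linarith) hb0] at hb
  nlinarith

/-- Two functions which no output serves well at the same time have to be distinguished. -/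
lemma GroverSchedule.queries_mul_angle_ge (S : GroverSchedule)
    (g : (Fin S.m → ℝ) → ProbabilityMeasure ℝ) {ε : ℝ} (hε : 0 < ε) {M : ℕ}
    (f f' : Fin M → Bool) (hK : (1 + ε) ^ 2 * (numMarked f : ℝ) < numMarked f')
    (h : 2 / 3 ≤ S.successProbRand g ε f) (h' : 2 / 3 ≤ S.successProbRand g ε f') :
    1 / 6 ≤ S.queries * |groverAngle f - groverAngle f'| := by
  set A : (Fin S.m → ℕ) → ℝ := fun k =>
    (g (S.estimates k) : Measure ℝ).real {x | Approx ε x (numMarked f)} with hA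
  set A' : (Fin S.m → ℕ) → ℝ := fun k =>
    (g (S.estimates k) : Measure ℝ).real {x | Approx ε x (numMarked f')} with hA'
  have hmeas : ∀ b : ℝ, MeasurableSet {x | Approx ε x b} := by
    intro b
    simp only [Approx]
    measurability
  have hsum : ∀ k, A k + A' k ≤ 1 := by
    intro k
    rw [hA, hA', ← measureReal_union _ (hmeas _)]
    · exact measureReal_le_one
    · rw [Set.disjoint_left]
      exact fun x hx => not_approx_of_lt hε hK hx
  have hA0 : ∀ k, 0 ≤ A k := fun k => measureReal_nonneg
  have hA0' : ∀ k, 0 ≤ A' k := fun k => measureReal_nonneg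
  have hb := S.abs_integral_law_sub_le f f' A'
    fun k => ⟨hA0' k, by linarith [hA0 k, hsum k]⟩
  have hint : ∀ B : (Fin S.m → ℕ) → ℝ, (∀ k, 0 ≤ B k) → (∀ k, B k ≤ 1) →
      Integrable B (S.law f) := by
    intro B h0 h1
    refine Integrable.of_bound (C := 1) Measurable.of_discrete.aestronglyMeasurable
      (Filter.Eventually.of_forall fun x => ?_)
    rw [Real.norm_eq_abs, abs_le]
    exact ⟨by linarith [h0 x], h1 x⟩
  have h1 : ∫ k, A k ∂(S.law f) + ∫ k, A' k ∂(S.law f) ≤ 1 := by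
    rw [← integral_add (hint A hA0 fun k => by linarith [hA0' k, hsum k])
      (hint A' hA0' fun k => by linarith [hA0 k, hsum k])]
    calc _ ≤ ∫ _, (1 : ℝ) ∂(S.law f) := by
          refine integral_mono_of_nonneg (Filter.Eventually.of_forall fun k => ?_)
            (integrable_const _) (Filter.Eventually.of_forall hsum)
          exact add_nonneg (hA0 k) (hA0' k)
      _ = 1 := by simp
  rw [GroverSchedule.successProbRand] at h h'
  -- Under `f` the mean of `A'` is at most `1/3`, under `f'` at least `2/3`; the gap `1/3` is at
  -- most `2 · queries · |Δθ|`.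
  have := (abs_le.mp hb).1
  change 2 / 3 ≤ ∫ k, A k ∂(S.law f) at h
  change 2 / 3 ≤ ∫ k, A' k ∂(S.law f') at h'
  linarith

lemma groverAngle_nonneg {M : ℕ} (f : Fin M → Bool) : 0 ≤ groverAngle f :=
  Real.arcsin_nonneg.mpr (Real.sqrt_nonneg _)

lemma groverAngle_le_pi_div_two {M : ℕ} (f : Fin M → Bool) : groverAngle f ≤ Real.pi / 2 :=
  Real.arcsin_le_pi_div_two _

/-- From `(K' - K)/M = sin (θ' - θ) sin (θ' + θ)`: the first factor is at least half the difference
of the angles, and the second at least `sin θ' cos θ ≥ √(K'/M)/2`. -/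
lemma groverAngle_sub_le {M : ℕ} (hM : 0 < M) (f f' : Fin M → Bool)
    (hle : numMarked f < numMarked f') (hf : 2 * numMarked f ≤ M) :
    |groverAngle f - groverAngle f'| ≤
      4 * (numMarked f' - numMarked f) / Real.sqrt (M * numMarked f') := by
  have hM' : (0 : ℝ) < M := by exact_mod_cast hM
  have hlt : (numMarked f : ℝ) < numMarked f' := by exact_mod_cast hle
  have hK' : (0 : ℝ) < numMarked f' := lt_of_le_of_lt (by positivity) hlt
  have hs : Real.sqrt ((numMarked f' : ℝ) / M) ≤ 2 * Real.sin (groverAngle f + groverAngle f') := by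
    rw [Real.sin_add]
    have h0 : 0 ≤ Real.sin (groverAngle f) * Real.cos (groverAngle f') := by
      rw [sin_groverAngle, cos_groverAngle]; positivity
    have h1 : 1 / 2 ≤ Real.cos (groverAngle f) := by
      rw [cos_groverAngle]
      apply Real.le_sqrt_of_sq_le
      have : (numMarked f : ℝ) / M ≤ 1 / 2 := by
        rw [div_le_div_iff₀ hM' two_pos]
        exact_mod_cast (by linarith : numMarked f * 2 ≤ 1 * M)
      linarith
    rw [sin_groverAngle f']
    nlinarith [Real.sqrt_nonneg ((numMarked f' : ℝ) / M)]
  have hmono : groverAngle f ≤ groverAngle f' := by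
    apply Real.monotone_arcsin
    apply Real.sqrt_le_sqrt
    gcongr
  set d := groverAngle f' - groverAngle f with hd
  have hd0 : 0 ≤ d := sub_nonneg.mpr hmono
  have hd1 : d ≤ Real.pi / 2 := by
    linarith [groverAngle_nonneg f, groverAngle_le_pi_div_two f']
  have hsd := Real.mul_le_sin hd0 hd1
  have e := sin_sq_sub_sin_sq (groverAngle f') (groverAngle f)
  rw [sin_groverAngle, sin_groverAngle, Real.sq_sqrt (by positivity), Real.sq_sqrt (by positivity),
    ← sub_div, ← hd, add_comm] at e
  rw [abs_sub_comm, abs_of_nonneg hd0, le_div_iff₀ (by positivity)]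
  have hpi : 1 / 2 ≤ 2 / Real.pi := by
    rw [div_le_div_iff₀ two_pos Real.pi_pos]; linarith [Real.pi_le_four]
  have h3 : d / 2 ≤ Real.sin d := by nlinarith
  have h4 : d / 2 * (Real.sqrt ((numMarked f' : ℝ) / M) / 2) ≤
      ((numMarked f' : ℝ) - numMarked f) / M := by
    rw [e]
    exact mul_le_mul h3 (by linarith) (by positivity) (by linarith)
  have h5 : Real.sqrt (M * numMarked f') = M * Real.sqrt ((numMarked f' : ℝ) / M) := by
    rw [← Real.sqrt_sq hM'.le, ← Real.sqrt_mul (sq_nonneg _), Real.sqrt_sq hM'.le]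
    congr 1
    field_simp
  rw [h5]
  rw [le_div_iff₀ hM'] at h4
  linarith

theorem queries_lower_bound {N M : ℕ} {ε : ℝ} (hN : 2 ^ 24 ≤ N) (hNM : N ≤ M)
    (hε : 1 / (N : ℝ) ≤ ε) (hε1 : ε ≤ 1) (S : GroverSchedule)
    (g : (Fin S.m → ℝ) → ProbabilityMeasure ℝ)
    (h : ∀ f : Fin N → Bool, 1 ≤ numMarked f → 2 ^ 20 * numMarked f ≤ N →
      2 / 3 ≤ S.successProbRand g ε (pad M f)) :
    1 / 1000000 * Real.sqrt (N / ε) ≤ S.queries := by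
  have hN0 : (0 : ℝ) < N := by exact_mod_cast (by omega : 0 < N)
  have hM0 : (0 : ℝ) < M := by exact_mod_cast (by omega : 0 < M)
  have hε0 : 0 < ε := lt_of_lt_of_le (by positivity) hε
  -- The ceiling keeps `εK ≤ 2`, hence `(1 + ε)²K ≤ K + 6 < K + 7`. The other term keeps `K + 7`
  -- admissible; as `ε ≥ 1/N`, it costs only a constant factor in `hlow`.
  set K := min ⌈1 / ε⌉₊ (N / 2 ^ 20 - 7) with hKdef
  have hc : 0 < ⌈1 / ε⌉₊ := Nat.ceil_pos.mpr (by positivity)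
  have hK1 : 1 ≤ K := by omega
  have hK2 : 2 ^ 20 * (K + 7) ≤ N := by omega
  obtain ⟨f, hf⟩ := exists_numMarked_eq (N := N) (K := K) (by omega)
  obtain ⟨f', hf'⟩ := exists_numMarked_eq (N := N) (K := K + 7) (by omega)
  have p1 := h f (by omega) (by omega)
  have p2 := h f' (by omega) (by omega)
  have n1 := numMarked_pad hNM f
  have n2 := numMarked_pad hNM f'
  rw [hf] at n1
  rw [hf'] at n2
  have hKε : ε * K ≤ 2 := by
    have h1 : (K : ℝ) ≤ ⌈1 / ε⌉₊ := by exact_mod_cast min_le_left _ _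
    have h2 := Nat.ceil_lt_add_one (show 0 ≤ 1 / ε by positivity)
    calc ε * K ≤ ε * (1 / ε + 1) := by gcongr; linarith
      _ = 1 + ε := by field_simp
      _ ≤ 2 := by linarith
  have hsep : (1 + ε) ^ 2 * (numMarked (pad M f) : ℝ) < numMarked (pad M f') := by
    rw [n1, n2]
    push_cast
    nlinarith [mul_le_mul_of_nonneg_left hε1 (by positivity : 0 ≤ ε * (K : ℝ))]
  have hQ := S.queries_mul_angle_ge g hε0 _ _ hsep p1 p2
  have hA := groverAngle_sub_le (by omega) (pad M f) (pad M f') (by omega) (by omega)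
  rw [n1, n2] at hA
  have hlow : 1 / (2 ^ 22 * ε) ≤ ((K + 7 : ℕ) : ℝ) := by
    rcases min_choice ⌈1 / ε⌉₊ (N / 2 ^ 20 - 7) with hm | hm
    · have := Nat.le_ceil (1 / ε)
      rw [← hm, ← hKdef] at this
      rw [← div_div, div_right_comm]
      push_cast
      have : 0 < 1 / ε := by positivity
      linarith
    · have h2 : N ≤ 2 ^ 22 * (K + 7) := by omega
      have h3 : (N : ℝ) ≤ 2 ^ 22 * ((K + 7 : ℕ) : ℝ) := by exact_mod_cast h2
      rw [div_le_iff₀ hN0] at hε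
      rw [div_le_iff₀ (by positivity)]
      nlinarith
  have hr : Real.sqrt (N / ε) / 2 ^ 11 ≤ Real.sqrt (M * ((K + 7 : ℕ) : ℝ)) := by
    apply Real.le_sqrt_of_sq_le
    rw [div_pow, Real.sq_sqrt (by positivity)]
    have h3 : (N : ℝ) ≤ M := by exact_mod_cast hNM
    calc (N : ℝ) / ε / (2 ^ 11) ^ 2 = N * (1 / (2 ^ 22 * ε)) := by field_simp
      _ ≤ _ := by gcongr
  have hpos : 0 < Real.sqrt (N / ε) := Real.sqrt_pos.mpr (by positivity)
  have hA2 : |groverAngle (pad M f) - groverAngle (pad M f')| ≤ 28 / (Real.sqrt (N / ε) / 2 ^ 11) := by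
    refine hA.trans ?_
    push_cast at hr ⊢
    rw [show (4 : ℝ) * (K + 7 - K) = 28 by ring]
    gcongr
  have hfin : 1 / 6 ≤ (S.queries : ℝ) * (28 / (Real.sqrt (N / ε) / 2 ^ 11)) :=
    hQ.trans (by gcongr)
  rw [mul_div_assoc', le_div_iff₀ (by positivity)] at hfin
  linarith

/-! ### Trisecting an interval of angles with one coin -/

/-- The `i`-th order used to trisect intervals of length `w` of angles of size about `1 / s`. -/
def refineOrder (s w : ℝ) (i : ℕ) : ℕ := ⌊(Real.pi / (2 * w) - i * (s / 50) - 1) / 2⌋₊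

/-- The ideal `r` are the odd multiples of `π/(4c)`. They have spacing `π/(2c) ≤ 2πs`, so one lies
within `6.3 s` below `π/(2w)`, and a grid of mesh `s/50` on this range comes close enough to it: `c`
is `O(1/s)`, so the phase `2rc` moves by less than `1/10`. -/
lemma exists_refineOrder {s u w : ℝ} (hs : 257 ≤ s) (hw : 0 < w) (hu : 1 / (4 * s) ≤ u)
    (hv : u + w ≤ 3 / (2 * s)) :
    ∃ i < 320, |Real.cos (2 * ((2 * refineOrder s w i + 1) * (u + w / 2)))| ≤ 1 / 10 ∧
      2 / 5 ≤ (2 * refineOrder s w i + 1) * w ∧ (2 * refineOrder s w i + 1) * w ≤ 8 / 5 := by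
  have hs0 : 0 < s := by linarith
  have hpi1 := Real.pi_gt_d2
  have hpi2 := Real.pi_lt_d2
  set c := u + w / 2 with hc
  have hu0 : 0 < u := lt_of_lt_of_le (by positivity) hu
  have hc0 : 0 < c := by positivity
  have hcl : 1 ≤ 4 * (s * c) := by
    rw [div_le_iff₀ (by positivity)] at hu
    nlinarith
  have hcu : s * c ≤ 3 / 2 := by
    rw [le_div_iff₀ (by positivity)] at hv
    nlinarith
  have hwu : s * w ≤ 5 / 4 := by
    rw [le_div_iff₀ (by positivity)] at hv
    rw [div_le_iff₀ (by positivity)] at hu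
    nlinarith
  have hcw : 1 / 2 ≤ c / w := by
    rw [le_div_iff₀ hw]; linarith
  -- With this `k`, `r₀` is the largest ideal value not exceeding `π/(2w)`.
  set k := ⌊c / w - 1 / 2⌋₊ with hk
  have hk1 : (k : ℝ) ≤ c / w - 1 / 2 := Nat.floor_le (by linarith)
  have hk2 : c / w - 1 / 2 < k + 1 := Nat.lt_floor_add_one _
  set r₀ := (k * (Real.pi / 2) + Real.pi / 4) / c with hr₀
  have hr₀c : r₀ * c = k * (Real.pi / 2) + Real.pi / 4 := div_mul_cancel₀ _ hc0.ne'
  set D := Real.pi / (2 * w) - r₀ with hD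
  have hDc : D * c = Real.pi / 2 * (c / w - 1 / 2 - k) := by
    rw [hD, sub_mul, hr₀c]; field_simp; ring
  have hD0 : 0 ≤ D := by
    have : 0 ≤ D * c := by rw [hDc]; exact mul_nonneg (by positivity) (by linarith)
    exact nonneg_of_mul_nonneg_left this hc0
  have hD1 : D ≤ 6.3 * s := by
    have h1 : D * c ≤ Real.pi / 2 := by
      rw [hDc]; nlinarith
    by_contra hcon
    push Not at hcon
    nlinarith [mul_lt_mul_of_pos_right hcon hc0]
  set i := ⌈D / (s / 50)⌉₊ with hi
  have hi1 : D ≤ i * (s / 50) := by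
    rw [← div_le_iff₀ (by positivity)]; exact Nat.le_ceil _
  have hi2 : i * (s / 50) < D + s / 50 := by
    have := Nat.ceil_lt_add_one (show 0 ≤ D / (s / 50) by positivity)
    rw [← lt_div_iff₀ (by positivity), add_div, div_self (by positivity)]
    exact this
  have hR : Real.pi / (2 * w) - i * (s / 50) = r₀ - (i * (s / 50) - D) := by rw [hD]; ring
  have hr₀s : s / 2 ≤ r₀ := by
    by_contra hcon
    push Not at hcon
    have := mul_lt_mul_of_pos_right hcon hc0
    rw [hr₀c] at this
    nlinarith [mul_nonneg (Nat.cast_nonneg (α := ℝ) k) Real.pi_pos.le]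
  set q := refineOrder s w i with hq
  have hq1 : 2 * (q : ℝ) + 1 ≤ r₀ := by
    have := Nat.floor_le (show 0 ≤ (Real.pi / (2 * w) - i * (s / 50) - 1) / 2 by
      rw [hR]; linarith)
    rw [← refineOrder, ← hq, hR] at this
    linarith
  -- The mesh loses `s/50`, rounding down to an odd integer loses `2`; the latter is negligible
  -- because `s ≥ 257`.
  have hq2 : r₀ - (s / 50 + 2) ≤ 2 * (q : ℝ) + 1 := by
    have := Nat.lt_floor_add_one ((Real.pi / (2 * w) - i * (s / 50) - 1) / 2)
    rw [← refineOrder, ← hq, hR] at this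
    linarith
  set r := 2 * (q : ℝ) + 1 with hr
  refine ⟨i, ?_, ?_, ?_, ?_⟩
  · have h1 : (i : ℝ) < 320 := by
      by_contra hcon
      push Not at hcon
      nlinarith [mul_le_mul_of_nonneg_right hcon (by positivity : 0 ≤ s / 50)]
    exact_mod_cast h1
  · have he : 2 * (r * c) = Real.pi / 2 - 2 * ((r₀ - r) * c) + k * Real.pi := by
      linear_combination 2 * hr₀c
    rw [he, Real.cos_add_nat_mul_pi, abs_mul, abs_pow, abs_neg, abs_one, one_pow, one_mul,
      Real.cos_pi_div_two_sub]
    refine Real.abs_sin_le_abs.trans ?_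
    rw [abs_of_nonneg (mul_nonneg two_pos.le (mul_nonneg (by linarith) hc0.le))]
    have h1 : (r₀ - r) * c ≤ (s / 50 + 2) * c :=
      mul_le_mul_of_nonneg_right (by linarith) hc0.le
    have h2 : 257 * c ≤ s * c := mul_le_mul_of_nonneg_right hs hc0.le
    linarith
  -- `r₀ w = (2k + 1)(π/4)/(c/w)` with `c/w < k + 3/2`; the worst case is `k = 0`.
  · have h1 : Real.pi / 6 ≤ r₀ * w := by
      have h2 : r₀ * w * (c / w) = k * (Real.pi / 2) + Real.pi / 4 := by
        rw [← hr₀c]; field_simp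
      by_contra hcon
      push Not at hcon
      have h3 : r₀ * w * (c / w) < Real.pi / 6 * (k + 3 / 2) := by
        have h4 : 0 ≤ r₀ * w := by positivity
        exact (mul_le_mul_of_nonneg_left (by linarith) h4).trans_lt
          (mul_lt_mul_of_pos_right hcon (by positivity))
      have h5 := mul_nonneg (Nat.cast_nonneg (α := ℝ) k) Real.pi_pos.le
      linarith
    have h4 : (r₀ - r) * w ≤ (s / 50 + 2) * w :=
      mul_le_mul_of_nonneg_right (by linarith) hw.le
    have h5 : 257 * w ≤ s * w := mul_le_mul_of_nonneg_right hs hw.le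
    linarith
  · have h1 : r₀ * w ≤ Real.pi / 2 := by
      have h2 : r₀ * w * (c / w) = k * (Real.pi / 2) + Real.pi / 4 := by
        rw [← hr₀c]; field_simp
      by_contra hcon
      push Not at hcon
      have h3 : Real.pi / 2 * (c / w) < r₀ * w * (c / w) := by
        apply mul_lt_mul_of_pos_right hcon; linarith
      have h4 : Real.pi / 2 * (k + 1 / 2) ≤ Real.pi / 2 * (c / w) :=
        mul_le_mul_of_nonneg_left (by linarith) (by positivity)
      linarith
    have h4 : r * w ≤ r₀ * w := mul_le_mul_of_nonneg_right hq1 hw.le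
    linarith

/-- With `φ = 2rc` and `z = r(x - c)` this bounds the second factor of `sin² (rx) - sin² (rc) = sin
z sin (φ + z)`. Together with `six_hundredths_le_sin` the product is at least `0.033 > 1/32`. -/
lemma le_sin_add {φ z : ℝ} (hc : |Real.cos φ| ≤ 1 / 10) (hs : 0 < Real.sin φ)
    (hz : |z| ≤ 4 / 5) : 11 / 20 ≤ Real.sin (φ + z) := by
  have h1 := Real.sin_sq_add_cos_sq φ
  have h2 : Real.cos φ ^ 2 ≤ 1 / 100 := by
    rw [← sq_abs]; nlinarith [abs_nonneg (Real.cos φ)]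
  have h3 : 99 / 100 ≤ Real.sin φ := by nlinarith
  have h4 : 68 / 100 ≤ Real.cos z := by
    have h5 := Real.one_sub_sq_div_two_le_cos (x := z)
    have h6 : z ^ 2 ≤ 16 / 25 := by
      rw [← sq_abs]; nlinarith [abs_nonneg z]
    linarith
  have h5 : |Real.cos φ * Real.sin z| ≤ 1 / 10 := by
    rw [abs_mul]
    calc _ ≤ (1 / 10 : ℝ) * 1 := mul_le_mul hc (Real.abs_sin_le_one _) (abs_nonneg _) (by norm_num)
      _ = _ := mul_one _
  rw [Real.sin_add]
  nlinarith [(abs_le.mp h5).1]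

lemma six_hundredths_le_sin {z : ℝ} (h1 : 1 / 10 ≤ z) (h2 : z ≤ 4 / 5) :
    6 / 100 ≤ Real.sin z := by
  have hpi1 := Real.pi_gt_d2
  have hpi2 := Real.pi_lt_d2
  have h3 := Real.mul_le_sin (x := z) (by linarith) (by linarith)
  have h4 : 63 / 100 ≤ 2 / Real.pi := by
    rw [le_div_iff₀ Real.pi_pos]; linarith
  nlinarith

/-- On an interval of length `w` with centre `c`, the bias of a suitable coin separates the outer
quarters from the centre. -/
lemma sin_sq_separation {r c w x : ℝ} (hc : |Real.cos (2 * (r * c))| ≤ 1 / 10)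
    (hw1 : 2 / 5 ≤ r * w) (hw2 : r * w ≤ 8 / 5) (hr : 0 < r)
    (hs : 0 < Real.sin (2 * (r * c))) :
    (c + w / 4 ≤ x → x ≤ c + w / 2 → 1 / 32 < Real.sin (r * x) ^ 2 - Real.sin (r * c) ^ 2) ∧
    (c - w / 2 ≤ x → x ≤ c - w / 4 → 1 / 32 < Real.sin (r * c) ^ 2 - Real.sin (r * x) ^ 2) := by
  have e : r * x + r * c = 2 * (r * c) + r * (x - c) := by ring
  constructor
  · intro h1 h2
    have z1 : 1 / 10 ≤ r * (x - c) := by nlinarith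
    have z2 : r * (x - c) ≤ 4 / 5 := by nlinarith
    rw [sin_sq_sub_sin_sq, e, ← mul_sub]
    have := le_sin_add hc hs (z := r * (x - c)) (by rw [abs_of_nonneg] <;> linarith)
    have := six_hundredths_le_sin z1 z2
    nlinarith
  · intro h1 h2
    have z1 : 1 / 10 ≤ r * (c - x) := by nlinarith
    have z2 : r * (c - x) ≤ 4 / 5 := by nlinarith
    rw [sin_sq_sub_sin_sq, add_comm, e, ← mul_sub]
    have := le_sin_add hc hs (z := r * (x - c)) (by rw [abs_le]; constructor <;> linarith)
    have := six_hundredths_le_sin z1 z2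
    nlinarith

lemma sin_sq_separation_of_neg {r c w x : ℝ} (hc : |Real.cos (2 * (r * c))| ≤ 1 / 10)
    (hw1 : 2 / 5 ≤ r * w) (hw2 : r * w ≤ 8 / 5) (hr : 0 < r)
    (hs : Real.sin (2 * (r * c)) < 0) :
    (c + w / 4 ≤ x → x ≤ c + w / 2 → 1 / 32 < Real.sin (r * c) ^ 2 - Real.sin (r * x) ^ 2) ∧
    (c - w / 2 ≤ x → x ≤ c - w / 4 → 1 / 32 < Real.sin (r * x) ^ 2 - Real.sin (r * c) ^ 2) := by
  have hc' : |Real.cos (-(2 * (r * c)))| ≤ 1 / 10 := by rwa [Real.cos_neg]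
  have hs' : 0 < Real.sin (-(2 * (r * c))) := by rw [Real.sin_neg]; linarith
  have e : Real.sin (r * x + r * c) = -Real.sin (-(2 * (r * c)) + -(r * (x - c))) := by
    rw [← Real.sin_neg]; congr 1; ring
  constructor
  · intro h1 h2
    have z1 : 1 / 10 ≤ r * (x - c) := by nlinarith
    have z2 : r * (x - c) ≤ 4 / 5 := by nlinarith
    rw [← neg_sub, sin_sq_sub_sin_sq, e, ← mul_sub]
    have := le_sin_add hc' hs' (z := -(r * (x - c))) (by rw [abs_le]; constructor <;> linarith)
    have := six_hundredths_le_sin z1 z2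
    nlinarith
  · intro h1 h2
    have z1 : 1 / 10 ≤ r * (c - x) := by nlinarith
    have z2 : r * (c - x) ≤ 4 / 5 := by nlinarith
    rw [← neg_sub, sin_sq_sub_sin_sq, add_comm, e, ← mul_sub]
    have := le_sin_add hc' hs' (z := -(r * (x - c))) (by rw [abs_le]; constructor <;> linarith)
    have := six_hundredths_le_sin z1 z2
    nlinarith

/-! ### Decision trees -/

/-- The refinement tree: `L` trisections locate an angle in `[u, u + w (4/3)^L]` up to `w`. -/
lemma exists_refineTree {s w : ℝ} (hs : 257 ≤ s) (hw : 0 < w) {m : ℕ} (leaf : ℝ → ℝ) (L : ℕ) :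
    ∀ (coin : Fin L → Fin 320 → Fin m) (u : ℝ), 1 / (4 * s) ≤ u →
      u + w * (4 / 3) ^ L ≤ 3 / (2 * s) →
      ∃ P : PostProcessing m, P.steps ≤ L ∧ ∀ (θ : ℝ) (p : Fin m → ℝ),
        u ≤ θ → θ ≤ u + w * (4 / 3) ^ L →
        (∀ l i, |p (coin l i) -
          Real.sin ((2 * refineOrder s (w * (4 / 3) ^ ((l : ℕ) + 1)) i + 1) * θ) ^ 2| < 1 / 32) →
        ∃ c, |c - θ| ≤ w ∧ 1 / (4 * s) ≤ c ∧ c ≤ 3 / (2 * s) ∧ P.run p = leaf c := by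
  induction L with
  | zero =>
    intro _ u hu hv
    -- Any point of the last interval is within `w` of the angle; the left endpoint is taken.
    refine ⟨.output (leaf u), le_rfl, fun θ p h1 h2 _ => ⟨u, ?_, hu, ?_, rfl⟩⟩
    · rw [pow_zero, mul_one] at h2
      rw [abs_le]; constructor <;> linarith
    · rw [pow_zero, mul_one] at hv
      linarith
  | succ L ih =>
    intro coin u hu hv
    set W := w * (4 / 3) ^ (L + 1) with hW
    have hW0 : 0 < W := by positivity
    have hWL : w * (4 / 3) ^ L = 3 / 4 * W := by rw [hW, pow_succ]; ring
    obtain ⟨i, hi, hc, hw1, hw2⟩ := exists_refineOrder hs hW0 hu hv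
    set r := 2 * (refineOrder s W i : ℝ) + 1 with hr
    have hr0 : 0 < r := by positivity
    set c := u + W / 2 with hcdef
    -- `A` and `B` handle the left and the right three quarters. These overlap in the middle half,
    -- where either outcome of the comparison is acceptable.
    obtain ⟨A, hA, hA'⟩ := ih (fun l => coin l.castSucc) u hu (by rw [hWL]; linarith)
    obtain ⟨B, hB, hB'⟩ := ih (fun l => coin l.castSucc) (u + W / 4) (by linarith)
      (by rw [hWL]; linarith)
    have goA : ∀ (θ : ℝ) (p : Fin m → ℝ), u ≤ θ → θ < c + W / 4 →
        (∀ l i, |p (coin l i) - Real.sin ((2 * refineOrder s (w * (4 / 3) ^ ((l : ℕ) + 1)) i + 1)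
          * θ) ^ 2| < 1 / 32) →
        ∃ c, |c - θ| ≤ w ∧ 1 / (4 * s) ≤ c ∧ c ≤ 3 / (2 * s) ∧ A.run p = leaf c :=
      fun θ p h1 h2 h3 => hA' θ p h1 (by rw [hWL]; linarith) fun l i => h3 l.castSucc i
    have goB : ∀ (θ : ℝ) (p : Fin m → ℝ), c - W / 4 < θ → θ ≤ u + W →
        (∀ l i, |p (coin l i) - Real.sin ((2 * refineOrder s (w * (4 / 3) ^ ((l : ℕ) + 1)) i + 1)
          * θ) ^ 2| < 1 / 32) →
        ∃ c, |c - θ| ≤ w ∧ 1 / (4 * s) ≤ c ∧ c ≤ 3 / (2 * s) ∧ B.run p = leaf c :=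
      fun θ p h1 h2 h3 => hB' θ p (by linarith) (by rw [hWL]; linarith) fun l i => h3 l.castSucc i
    have hsin : Real.sin (2 * (r * c)) ≠ 0 := by
      intro h0
      have h1 := Real.sin_sq_add_cos_sq (2 * (r * c))
      rw [h0, ← sq_abs (Real.cos _)] at h1
      nlinarith [abs_nonneg (Real.cos (2 * (r * c)))]
    -- Levels count up from the shortest interval, so the present, longest one has the last index.
    set j : Fin m := coin (Fin.last L) ⟨i, hi⟩ with hj
    have hgood : ∀ (θ : ℝ) (p : Fin m → ℝ),
        (∀ l i, |p (coin l i) - Real.sin ((2 * refineOrder s (w * (4 / 3) ^ ((l : ℕ) + 1)) i + 1)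
          * θ) ^ 2| < 1 / 32) → |p j - Real.sin (r * θ) ^ 2| < 1 / 32 :=
      fun θ p h3 => h3 (Fin.last L) ⟨i, hi⟩
    -- The sign of `sin (2rc)` is the direction in which the bias is monotone, and decides which
    -- subtree lies below the threshold.
    rcases hsin.lt_or_gt with hneg | hpos
    · refine ⟨.compare j (Real.sin (r * c) ^ 2) B A, ?_, fun θ p h1 h2 h3 => ?_⟩
      · rw [PostProcessing.steps]; omega
      · have hg := abs_lt.mp (hgood θ p h3)
        have hsep := sin_sq_separation_of_neg (x := θ) hc hw1 hw2 hr0 hneg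
        rw [PostProcessing.run]
        split_ifs with hlt
        · refine goB θ p ?_ h2 h3
          by_contra hcon
          push Not at hcon
          have := hsep.2 (by linarith) hcon
          linarith
        · refine goA θ p h1 ?_ h3
          by_contra hcon
          push Not at hcon
          have := hsep.1 hcon (by linarith)
          linarith
    · refine ⟨.compare j (Real.sin (r * c) ^ 2) A B, ?_, fun θ p h1 h2 h3 => ?_⟩
      · rw [PostProcessing.steps]; omega
      · have hg := abs_lt.mp (hgood θ p h3)
        have hsep := sin_sq_separation (x := θ) hc hw1 hw2 hr0 hpos
        rw [PostProcessing.run]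
        split_ifs with hlt
        · refine goA θ p h1 ?_ h3
          by_contra hcon
          push Not at hcon
          have := hsep.1 hcon (by linarith)
          linarith
        · refine goB θ p ?_ h2 h3
          by_contra hcon
          push Not at hcon
          have := hsep.2 (by linarith) hcon
          linarith

lemma one_fourth_le_of_sin_sq {x : ℝ} (h0 : 0 ≤ x) (h : 3 / 32 < Real.sin x ^ 2) : 1 / 4 ≤ x := by
  by_contra hcon
  push Not at hcon
  have h1 := Real.sin_le h0
  have h2 := Real.sin_nonneg_of_nonneg_of_le_pi h0 (by linarith [Real.pi_gt_three])
  nlinarith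

lemma le_of_sin_sq_lt {x : ℝ} (h0 : 0 ≤ x) (h1 : x ≤ 3 / 2) (h : Real.sin x ^ 2 < 5 / 32) :
    x ≤ 3 / 4 := by
  by_contra hcon
  push Not at hcon
  have hpi1 := Real.pi_gt_d2
  have hpi2 := Real.pi_lt_d2
  have h3 := Real.mul_le_sin (x := x) h0 (by linarith)
  have h4 : 63 / 100 ≤ 2 / Real.pi := by
    rw [le_div_iff₀ Real.pi_pos]; linarith
  have h5 : 47 / 100 ≤ Real.sin x := by nlinarith
  nlinarith

/-- The scan for the scale of the angle: the first coin of order `2^(a+j)` with a substantial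
number of heads selects the tree to go on with. -/
lemma exists_scanTree {m B : ℕ} (n : ℕ) :
    ∀ (a : ℕ) (coin : Fin n → Fin m) (Q : Fin n → PostProcessing m), (∀ j, (Q j).steps ≤ B) →
      ∃ P : PostProcessing m, P.steps ≤ n + B ∧ ∀ (θ : ℝ) (p : Fin m → ℝ), 0 ≤ θ →
        (2 ^ a + 1) * θ ≤ 3 / 2 → 3 / 2 < (2 ^ (a + n) + 1) * θ →
        (∀ j, |p (coin j) - Real.sin ((2 ^ (a + (j : ℕ)) + 1) * θ) ^ 2| < 1 / 32) →
        ∃ j : Fin n, 1 / 4 ≤ (2 ^ (a + (j : ℕ)) + 1) * θ ∧ (2 ^ (a + (j : ℕ)) + 1) * θ ≤ 3 / 2 ∧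
          P.run p = (Q j).run p := by
  induction n with
  | zero =>
    intro a _ _ _
    -- With no scale left the two bounds on the angle contradict each other, so the output is
    -- arbitrary.
    refine ⟨.output 0, Nat.zero_le _, fun θ p _ h1 h2 _ => ?_⟩
    rw [add_zero] at h2
    linarith
  | succ n ih =>
    intro a coin Q hQ
    obtain ⟨P, hP, hP'⟩ := ih (a + 1) (fun j => coin j.succ) (fun j => Q j.succ)
      fun j => hQ j.succ
    refine ⟨.compare (coin 0) (1 / 8) P (Q 0), ?_, fun θ p h0 h1 h2 h3 => ?_⟩
    · rw [PostProcessing.steps]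
      have := hQ 0
      omega
    · have hg := h3 0
      rw [Fin.val_zero, add_zero, abs_lt] at hg
      have hx0 : 0 ≤ (2 ^ a + 1) * θ := by positivity
      have ea : ∀ k : ℕ, a + 1 + k = a + (k + 1) := fun k => by omega
      rw [PostProcessing.run]
      split_ifs with hlt
      -- An average below `1/8` puts the phase at no more than `3/4`. The next scale at most doubles
      -- it, so it stays below `3/2`, where small `sin²` still means small phase.
      · have hx := le_of_sin_sq_lt hx0 h1 (by linarith)
        obtain ⟨j, hj1, hj2, hj3⟩ := hP' θ p h0 (by rw [pow_succ]; nlinarith)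
          (by rwa [ea]) fun j => by simpa only [ea, Fin.val_succ] using h3 j.succ
        refine ⟨j.succ, ?_, ?_, hj3⟩
        · simpa only [ea, Fin.val_succ] using hj1
        · simpa only [ea, Fin.val_succ] using hj2
      · refine ⟨0, ?_, ?_, rfl⟩
        · rw [Fin.val_zero, add_zero]
          exact one_fourth_le_of_sin_sq hx0 (by linarith)
        · rwa [Fin.val_zero, add_zero]

/-! ### Schedules indexed by a finite type -/

/-- The schedule flipping, for each `i : ι`, the coin of order `q i` exactly `t i` times. -/
def coinSchedule {ι : Type} [Fintype ι] (q t : ι → ℕ) (ht : ∀ i, 0 < t i) : GroverSchedule where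
  m := Fintype.card ι
  r i := 2 * q ((Fintype.equivFin ι).symm i) + 1
  t i := t ((Fintype.equivFin ι).symm i)
  one_le_r i := by
    have : (0 : ℝ) ≤ q ((Fintype.equivFin ι).symm i) := Nat.cast_nonneg _
    linarith
  t_pos i := ht _

lemma groverIters_odd (q : ℕ) : groverIters (2 * q + 1) = q := by
  rw [groverIters, add_sub_cancel_right, mul_div_cancel_left₀ _ two_ne_zero, Nat.floor_natCast]

lemma coinSchedule_queries {ι : Type} [Fintype ι] (q t : ι → ℕ) (ht : ∀ i, 0 < t i) :
    (coinSchedule q t ht).queries = ∑ i, t i * (q i + 1) := by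
  have h := Equiv.sum_comp (Fintype.equivFin ι).symm fun i => t i * (q i + 1)
  rw [← h, GroverSchedule.queries]
  refine Finset.sum_congr rfl fun i _ => ?_
  simp only [coinSchedule, groverIters_odd]

/-- A post-processing that works whenever the estimates indexed by `I` are accurate succeeds with
high probability. -/
lemma coinSchedule_successProb {ι : Type} [Fintype ι] (q t : ι → ℕ) (ht : ∀ i, 0 < t i)
    (g : (Fin (Fintype.card ι) → ℝ) → ℝ) {ε η : ℝ} (hη : 0 ≤ η) (hη1 : η ≤ 1) {M : ℕ}
    (f : Fin M → Bool) (I : Finset ι)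
    (hg : ∀ p : Fin (Fintype.card ι) → ℝ,
      (∀ i ∈ I, |p (Fintype.equivFin ι i) - Real.sin ((2 * q i + 1) * groverAngle f) ^ 2| < η) →
      Approx ε (g p) (numMarked f)) :
    1 - ∑ i ∈ I, 2 * Real.exp (-(t i * (η ^ 2 / 4))) ≤
      (coinSchedule q t ht).successProb g ε f := by
  set S := coinSchedule q t ht with hS
  set e := Fintype.equivFin ι with he
  let bad : ι → Set (Fin S.m → ℕ) := fun i =>
    {k | η ≤ |S.estimates k (e i) - Real.sin ((2 * q i + 1) * groverAngle f) ^ 2|}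
  have hbad : ∀ i, (S.law f).real (bad i) ≤ 2 * Real.exp (-(t i * (η ^ 2 / 4))) := by
    intro i
    have hmp := measurePreserving_eval (fun i : Fin S.m => ProbabilityTheory.binomial (S.t i)
      ⟨groverProb f (groverIters (S.r i)), groverProb_mem f (groverIters (S.r i))⟩) (e i)
    have hc := binomial_concentration (S.t_pos (e i))
      ⟨groverProb f (groverIters (S.r (e i))), groverProb_mem f (groverIters (S.r (e i)))⟩ hη hη1
    rw [← hmp.measureReal_preimage (MeasurableSet.of_discrete.nullMeasurableSet)] at hc
    have ht' : S.t (e i) = t i := congrArg t (e.symm_apply_apply i)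
    have hq' : groverIters (S.r (e i)) = q i := by
      change groverIters (2 * q (e.symm (e i)) + 1) = q i
      rw [e.symm_apply_apply, groverIters_odd]
    have hset : bad i = Function.eval (e i) ⁻¹' {k : ℕ |
        η ≤ |(k : ℝ) / S.t (e i) - groverProb f (groverIters (S.r (e i)))|} := by
      rw [groverProb_eq, hq']
      rfl
    rw [hset, ← ht']
    exact hc
  have hsub : (⋃ i ∈ I, bad i)ᶜ ⊆ {k | Approx ε (g (S.estimates k)) (numMarked f)} := by
    intro k hk
    refine hg _ fun i hi => ?_
    by_contra hcon
    exact hk (Set.mem_biUnion hi (not_lt.mp hcon))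
  calc _ ≤ 1 - ∑ i ∈ I, (S.law f).real (bad i) := by
        gcongr with i _; exact hbad i
    _ ≤ 1 - (S.law f).real (⋃ i ∈ I, bad i) := by
        gcongr; exact measureReal_biUnion_finset_le _ _
    _ = (S.law f).real (⋃ i ∈ I, bad i)ᶜ := by
        rw [probReal_compl_eq_one_sub MeasurableSet.of_discrete]
    _ ≤ _ := measureReal_mono hsub

/-! ### Sums -/

lemma sum_pow_succ_le {x : ℝ} (h0 : 0 ≤ x) (h1 : x ≤ 1 / 2) (n : ℕ) :
    ∑ l : Fin n, x ^ ((l : ℕ) + 1) ≤ 2 * x := by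
  have h : ∑ l ∈ Finset.range n, x ^ (l + 1) + 2 * x ^ (n + 1) ≤ 2 * x := by
    induction n with
    | zero => simp
    | succ n ih =>
      rw [Finset.sum_range_succ]
      have : x ^ (n + 1 + 1) ≤ 1 / 2 * x ^ (n + 1) := by
        rw [pow_succ, mul_comm]; gcongr
      linarith
  rw [Fin.sum_univ_eq_sum_range fun l => x ^ (l + 1)]
  have : 0 ≤ x ^ (n + 1) := by positivity
  linarith

lemma sum_succ_mul_pow_le (n : ℕ) :
    ∑ l : Fin n, (((l : ℕ) : ℝ) + 1) * (3 / 4 : ℝ) ^ (l : ℕ) ≤ 16 := by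
  have h : ∑ l ∈ Finset.range n, ((l : ℝ) + 1) * (3 / 4 : ℝ) ^ l
      = 16 - (16 + 4 * n) * (3 / 4 : ℝ) ^ n := by
    induction n with
    | zero => simp
    | succ n ih =>
      rw [Finset.sum_range_succ, ih]
      push_cast
      ring
  rw [Fin.sum_univ_eq_sum_range fun l => ((l : ℝ) + 1) * (3 / 4 : ℝ) ^ l, h]
  have : 0 ≤ (16 + 4 * (n : ℝ)) * (3 / 4 : ℝ) ^ n := by positivity
  linarith

/-- The terms grow geometrically until both expressions are near `√(ab)`, and decay geometrically
afterwards. The bounds `a 2^n` and `4g - 2b/2^n` are the inductive forms for the two regimes; `h2`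
joins them at the crossing. -/
lemma sum_min_geometric_le {a b : ℝ} (ha : 0 < a) (hb : 0 < b) (n : ℕ) :
    ∑ j : Fin n, min (a * 2 ^ (j : ℕ)) (b / 2 ^ (j : ℕ)) ≤ 4 * Real.sqrt (a * b) := by
  rw [Fin.sum_univ_eq_sum_range fun j => min (a * 2 ^ j) (b / 2 ^ j)]
  set g := Real.sqrt (a * b) with hg
  have hg0 : 0 < g := Real.sqrt_pos.mpr (by positivity)
  have hgg : g * g = a * b := Real.mul_self_sqrt (by positivity)
  have h1 : ∀ n : ℕ, ∑ j ∈ Finset.range n, min (a * 2 ^ j) (b / 2 ^ j) ≤ a * 2 ^ n := by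
    intro n
    induction n with
    | zero => simp [ha.le]
    | succ n ih =>
      rw [Finset.sum_range_succ, pow_succ]
      linarith [min_le_left (a * 2 ^ n) (b / 2 ^ n)]
  have h2 : ∀ n : ℕ, g ≤ a * 2 ^ n → a * 2 ^ n ≤ 2 * g →
      a * 2 ^ n ≤ 4 * g - 2 * (b / 2 ^ n) := by
    intro n hn hn'
    have e : (a * 2 ^ n) * (b / 2 ^ n) = g * g := by rw [hgg]; field_simp
    have hy : 0 < b / 2 ^ n := by positivity
    set x : ℝ := a * 2 ^ n
    set y := b / 2 ^ n
    nlinarith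
  have h3 : g ≤ a * 2 ^ n →
      ∑ j ∈ Finset.range n, min (a * 2 ^ j) (b / 2 ^ j) ≤ 4 * g - 2 * (b / 2 ^ n) := by
    induction n with
    | zero =>
      intro hn
      have e : (a * 2 ^ 0) * (b / 2 ^ 0) = g * g := by rw [hgg]; simp
      have hy : 0 < b / 2 ^ 0 := by positivity
      rw [Finset.range_zero, Finset.sum_empty]
      nlinarith
    | succ n ih =>
      intro hn
      by_cases hc : g ≤ a * 2 ^ n
      · rw [Finset.sum_range_succ]
        have e : b / 2 ^ (n + 1) = b / 2 ^ n / 2 := by rw [pow_succ]; field_simp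
        rw [e]
        linarith [min_le_right (a * 2 ^ n) (b / 2 ^ n), ih hc]
      · push Not at hc
        exact (h1 _).trans (h2 _ hn (by rw [pow_succ]; linarith))
  by_cases hc : g ≤ a * 2 ^ n
  · have : 0 ≤ b / 2 ^ n := by positivity
    linarith [h3 hc]
  · push Not at hc
    linarith [h1 n]

lemma exists_depth {w ρ : ℝ} (hρ : 0 < ρ) :
    ∃ L : ℕ, w * (3 / 4) ^ L ≤ ρ := by
  have h := (tendsto_pow_atTop_nhds_zero_of_lt_one (r := (3 / 4 : ℝ)) (by norm_num)
    (by norm_num)).const_mul w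
  rw [mul_zero] at h
  exact (h.eventually_le_const hρ).exists

/-! ### The output of the algorithm -/

/-- The estimate of `K = N sin² θ` from an approximation `c` to `θ ≈ 1 / s`: when the
approximation determines `K` exactly, it is rounded to an integer. -/
def leafOutput (N ε s c : ℝ) : ℝ :=
  if s / (8 * N) ≤ ε / (300 * s) then N * Real.sin c ^ 2 else ⌊N * Real.sin c ^ 2 + 1 / 2⌋

/-- On this scale `N sin²` has Lipschitz constant at most `3N/s`. Precision `s/(8N)` thus gives
error `3/8`, small enough to round. Precision `ε/(300s)` gives error `εN/(100s²)`, at most `εK/2`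
because `K ≥ N (63/(400s))²`. -/
lemma approx_leafOutput {N ε s c θ : ℝ} {K : ℕ} (hN : 0 < N) (hε : 0 < ε) (hε1 : ε ≤ 1)
    (hs : 1 ≤ s) (hK : 1 ≤ K) (hθK : N * Real.sin θ ^ 2 = K) (hθ1 : 1 / (4 * s) ≤ θ)
    (hθ2 : θ ≤ 3 / (2 * s)) (hc1 : 1 / (4 * s) ≤ c) (hc2 : c ≤ 3 / (2 * s))
    (hc : |c - θ| ≤ max (ε / (300 * s)) (s / (8 * N))) :
    Approx ε (leafOutput N ε s c) K := by
  have hs0 : 0 < s := by linarith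
  have hK0 : (1 : ℝ) ≤ K := by exact_mod_cast hK
  have hθ0 : 0 < θ := lt_of_lt_of_le (by positivity) hθ1
  have hc0 : 0 < c := lt_of_lt_of_le (by positivity) hc1
  have h3 : 3 / (2 * s) ≤ 3 / 2 := by
    rw [div_le_div_iff₀ (by positivity) two_pos]; linarith
  have hdist : |N * Real.sin c ^ 2 - K| ≤ |c - θ| * (N * (3 / s)) := by
    rw [← hθK, ← mul_sub, abs_mul, abs_of_pos hN, sin_sq_sub_sin_sq, abs_mul]
    have h1 : |Real.sin (c - θ)| ≤ |c - θ| := Real.abs_sin_le_abs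
    have h2 : |Real.sin (c + θ)| ≤ 3 / s := by
      refine Real.abs_sin_le_abs.trans ?_
      rw [abs_of_pos (by linarith)]
      have : 3 / s = 3 / (2 * s) + 3 / (2 * s) := by field_simp; norm_num
      linarith
    calc _ ≤ N * (|c - θ| * (3 / s)) := by gcongr
      _ = _ := by ring
  rw [leafOutput]
  split_ifs with hcase
  · rw [max_eq_left hcase] at hc
    have hsin : 63 / (400 * s) ≤ Real.sin θ := by
      have hpi1 := Real.pi_gt_d2
      have hpi2 := Real.pi_lt_d2
      have h4 := Real.mul_le_sin (x := θ) hθ0.le (by linarith)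
      have h5 : 63 / 100 ≤ 2 / Real.pi := by
        rw [le_div_iff₀ Real.pi_pos]; linarith
      calc 63 / (400 * s) = 63 / 100 * (1 / (4 * s)) := by field_simp; norm_num
        _ ≤ 2 / Real.pi * θ := by gcongr
        _ ≤ _ := h4
    have hKlow : N * (63 / (400 * s)) ^ 2 ≤ K := by
      rw [← hθK]; gcongr
    have herr : |N * Real.sin c ^ 2 - K| ≤ ε / 2 * K := by
      calc _ ≤ ε / (300 * s) * (N * (3 / s)) := hdist.trans (by gcongr)
        _ ≤ ε / 2 * (N * (63 / (400 * s)) ^ 2) := by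
          have h6 : 0 ≤ ε * N / s ^ 2 := by positivity
          have e1 : ε / (300 * s) * (N * (3 / s)) = 1 / 100 * (ε * N / s ^ 2) := by
            field_simp; norm_num
          have e2 : ε / 2 * (N * (63 / (400 * s)) ^ 2) = 3969 / 320000 * (ε * N / s ^ 2) := by
            field_simp; norm_num
          rw [e1, e2]
          linarith
        _ ≤ _ := by gcongr
    have hh := abs_le.mp herr
    refine ⟨by nlinarith, by linarith, ?_, ?_⟩
    · rw [div_le_div_iff₀ (by linarith) (by linarith)]
      nlinarith [mul_nonneg hε.le (sub_nonneg.mpr hε1)]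
    · rw [div_le_iff₀ (by linarith)]
      nlinarith
  · rw [max_eq_right (not_le.mp hcase).le] at hc
    have herr : |N * Real.sin c ^ 2 - K| ≤ 3 / 8 := by
      calc _ ≤ s / (8 * N) * (N * (3 / s)) := hdist.trans (by gcongr)
        _ = 3 / 8 := by field_simp
    have hh := abs_le.mp herr
    have hfl : ⌊N * Real.sin c ^ 2 + 1 / 2⌋ = (K : ℤ) := by
      rw [Int.floor_eq_iff]
      push_cast
      constructor <;> linarith
    rw [hfl, Int.cast_natCast]
    have hKne : (K : ℝ) ≠ 0 := by linarith
    refine ⟨by linarith, by linarith, ?_, ?_⟩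
    · rw [div_self hKne, div_le_one (by linarith)]; linarith
    · rw [div_self hKne]; linarith

/-! ### The nonadaptive algorithm -/

/-- The `j`-th scale: angles of size about `1 / scale j` are dealt with together. -/
def scale (j : ℕ) : ℝ := 2 ^ (8 + j) + 1

/-- The precision to which angles at the `j`-th scale have to be known. -/
def precision (N ε : ℝ) (j : ℕ) : ℝ := max (ε / (300 * scale j)) (scale j / (8 * N))

/-- The number of trisections at the `j`-th scale. -/
def depth (N ε : ℝ) (j : ℕ) : ℕ :=
  sInf {L : ℕ | 5 / (4 * scale j) * (3 / 4) ^ L ≤ precision N ε j}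

/-- The precision attained at the `j`-th scale. -/
def finalWidth (N ε : ℝ) (j : ℕ) : ℝ := 5 / (4 * scale j) * (3 / 4) ^ depth N ε j

lemma le_scale (j : ℕ) : 257 ≤ scale j := by
  have : (1 : ℝ) ≤ 2 ^ j := one_le_pow₀ one_le_two
  rw [scale, pow_add]
  linarith

lemma scale_pos (j : ℕ) : 0 < scale j := by linarith [le_scale j]

lemma precision_pos {N ε : ℝ} (hε : 0 < ε) (j : ℕ) : 0 < precision N ε j :=
  lt_max_of_lt_left (by have := scale_pos j; positivity)

lemma finalWidth_le_precision {N ε : ℝ} (hε : 0 < ε) (j : ℕ) :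
    finalWidth N ε j ≤ precision N ε j := by
  exact Nat.sInf_mem (exists_depth (w := 5 / (4 * scale j)) (precision_pos (N := N) hε j))

lemma precision_lt_of_lt_depth {N ε : ℝ} {j l : ℕ} (hl : l < depth N ε j) :
    precision N ε j < 5 / (4 * scale j) * (3 / 4) ^ l :=
  not_le.mp (Nat.notMem_of_lt_sInf hl)

lemma finalWidth_pos (N ε : ℝ) (j : ℕ) : 0 < finalWidth N ε j := by
  have := scale_pos j
  rw [finalWidth]; positivity

lemma finalWidth_mul (N ε : ℝ) (j : ℕ) :
    finalWidth N ε j * (4 / 3) ^ depth N ε j = 5 / (4 * scale j) := by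
  rw [finalWidth, mul_assoc, ← mul_pow]
  norm_num

/-- Minimality of the depth gives `ε (4/3)^l < 375` for `l = depth - 1`. Bernoulli's inequality
turns this into a linear bound, cruder than the logarithmic one but sufficient. -/
lemma depth_le {N ε : ℝ} (hε : 0 < ε) (j : ℕ) : (depth N ε j : ℝ) ≤ 1125 / ε := by
  have hs := scale_pos j
  rcases Nat.eq_zero_or_pos (depth N ε j) with h0 | hpos
  · rw [h0, Nat.cast_zero]; positivity
  · obtain ⟨l, hl⟩ := Nat.exists_eq_succ_of_ne_zero hpos.ne'
    have h1 := precision_lt_of_lt_depth (N := N) (ε := ε) (j := j) (l := l) (by omega)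
    have h2 := (le_max_left _ _).trans_lt h1
    have h3 : (1 : ℝ) + l * (1 / 3) ≤ (4 / 3) ^ l := by
      have := one_add_mul_le_pow (a := (1 / 3 : ℝ)) (by norm_num) l
      norm_num at this ⊢
      exact this
    have h4 : ε * (4 / 3 : ℝ) ^ l < 375 := by
      have e : (3 / 4 : ℝ) ^ l * (4 / 3 : ℝ) ^ l = 1 := by
        rw [← mul_pow]; norm_num
      have h5 := mul_lt_mul_of_pos_right h2 (by positivity : 0 < 300 * scale j * (4 / 3 : ℝ) ^ l)
      calc ε * (4 / 3 : ℝ) ^ l = ε / (300 * scale j) * (300 * scale j * (4 / 3 : ℝ) ^ l) := by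
            field_simp
        _ < _ := h5
        _ = 375 * ((3 / 4 : ℝ) ^ l * (4 / 3 : ℝ) ^ l) := by field_simp; norm_num
        _ = 375 := by rw [e, mul_one]
    rw [hl, le_div_iff₀ hε]
    push_cast
    nlinarith

lemma refineOrder_add_one_le {s w : ℝ} (hs : 0 ≤ s) (hw : 0 < w) (hw1 : w ≤ 1) (i : ℕ) :
    (refineOrder s w i : ℝ) + 1 ≤ 8 / (5 * w) := by
  have hpi1 := Real.pi_gt_d2
  have hpi2 := Real.pi_lt_d2
  have h1 : 1 ≤ Real.pi / (2 * w) := by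
    rw [le_div_iff₀ (by positivity)]; linarith
  have h2 : refineOrder s w i ≤ ⌊(Real.pi / (2 * w) - 1) / 2⌋₊ := by
    apply Nat.floor_mono
    have : 0 ≤ i * (s / 50) := by positivity
    linarith
  have h3 : (refineOrder s w i : ℝ) ≤ (Real.pi / (2 * w) - 1) / 2 :=
    le_trans (by exact_mod_cast h2) (Nat.floor_le (by linarith))
  have h4 : Real.pi / (2 * w) ≤ 8 / (5 * w) := by
    rw [div_le_div_iff₀ (by positivity) (by positivity)]
    nlinarith
  linarith

/-- The order is inversely proportional to the interval length. By minimality of the depth the final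
width is not much below the precision, so the `l`-th length is at least `precision · (4/3)^l`. -/
lemma refineOrder_cost {N ε : ℝ} (hε : 0 < ε) {j l : ℕ} (hl : l < depth N ε j) (i : ℕ) :
    (refineOrder (scale j) (finalWidth N ε j * (4 / 3) ^ (l + 1)) i : ℝ) + 1 ≤
      8 / 5 * (precision N ε j)⁻¹ * (3 / 4) ^ l := by
  have hs := le_scale j
  have hs0 := scale_pos j
  have hρ := precision_pos (N := N) hε j
  obtain ⟨d, hd⟩ := Nat.exists_eq_add_of_lt hl
  have hW : finalWidth N ε j * (4 / 3) ^ (l + 1) = 5 / (4 * scale j) * (3 / 4) ^ d := by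
    have e : (3 / 4 : ℝ) ^ (l + 1) * (4 / 3 : ℝ) ^ (l + 1) = 1 := by
      rw [← mul_pow]; norm_num
    rw [finalWidth, hd, show l + d + 1 = d + (l + 1) by ring, pow_add]
    linear_combination (5 / (4 * scale j) * (3 / 4) ^ d) * e
  have hlow : precision N ε j ≤ finalWidth N ε j * (4 / 3) ^ (l + 1) * (3 / 4) ^ l := by
    have := precision_lt_of_lt_depth (N := N) (ε := ε) (j := j) (l := d + l) (by omega)
    rw [hW, mul_assoc, ← pow_add]
    exact this.le
  have hW0 : 0 < finalWidth N ε j * (4 / 3) ^ (l + 1) := by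
    have := finalWidth_pos N ε j
    positivity
  have hW1 : finalWidth N ε j * (4 / 3) ^ (l + 1) ≤ 1 := by
    rw [hW]
    have h1 : 5 / (4 * scale j) ≤ 1 := by
      rw [div_le_one (by positivity)]; linarith
    exact mul_le_one₀ h1 (by positivity) (pow_le_one₀ (by norm_num) (by norm_num))
  refine (refineOrder_add_one_le hs0.le hW0 hW1 i).trans ?_
  rw [mul_assoc, inv_mul_eq_div, ← div_div, div_eq_mul_one_div]
  refine mul_le_mul (by norm_num) ?_ (by positivity) (by norm_num)
  rw [div_le_div_iff₀ hW0 hρ]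
  linarith

lemma sum_inv_precision_le {N ε : ℝ} (hN : 0 < N) (hε : 0 < ε) (n : ℕ) :
    ∑ j : Fin n, (precision N ε j)⁻¹ ≤ 280 * Real.sqrt (N / ε) := by
  -- From `2^8 · 2^j ≤ scale j ≤ 2^9 · 2^j` inserted into `300 · scale j / ε` and `8N / scale j`.
  have h := sum_min_geometric_le (a := 300 * 2 ^ 9 / ε) (b := N / 32) (by positivity)
    (by positivity) n
  have hsq : Real.sqrt (300 * 2 ^ 9 / ε * (N / 32)) ≤ 70 * Real.sqrt (N / ε) := by
    apply Real.sqrt_le_iff.mpr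
    refine ⟨by positivity, ?_⟩
    rw [mul_pow, Real.sq_sqrt (by positivity)]
    have e : 300 * 2 ^ 9 / ε * (N / 32) = 4800 * (N / ε) := by field_simp; norm_num
    have : 0 ≤ N / ε := by positivity
    rw [e]
    linarith
  refine (Finset.sum_le_sum fun j _ => ?_).trans (h.trans (by linarith))
  have hs := scale_pos j
  have hρ := precision_pos (N := N) hε j
  have hp : (1 : ℝ) ≤ 2 ^ (j : ℕ) := one_le_pow₀ one_le_two
  have hs1 : (2 : ℝ) ^ 8 * 2 ^ (j : ℕ) ≤ scale j := by rw [scale, pow_add]; linarith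
  have hs2 : scale j ≤ 2 ^ 9 * 2 ^ (j : ℕ) := by rw [scale, pow_add]; linarith
  refine le_min ?_ ?_
  · calc (precision N ε j)⁻¹ ≤ (ε / (300 * scale j))⁻¹ := by
          gcongr; exact le_max_left _ _
      _ = 300 / ε * scale j := by rw [inv_div]; ring
      _ ≤ 300 / ε * (2 ^ 9 * 2 ^ (j : ℕ)) := by gcongr
      _ = _ := by ring
  · calc (precision N ε j)⁻¹ ≤ (scale j / (8 * N))⁻¹ := by
          gcongr; exact le_max_right _ _
      _ = 8 * N / scale j := by rw [inv_div]
      _ ≤ 8 * N / (2 ^ 8 * 2 ^ (j : ℕ)) := by gcongr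
      _ = _ := by field_simp; norm_num

/-- The coins: one for each of `n` scales, and `320` for each trisection at each scale. -/
abbrev CoinIndex (N ε : ℝ) (n : ℕ) : Type :=
  Fin n ⊕ (Σ j : Fin n, Fin (depth N ε j) × Fin 320)

/-- The order of a coin. -/
def coinOrder (N ε : ℝ) (n : ℕ) : CoinIndex N ε n → ℕ
  | .inl j => 2 ^ (7 + (j : ℕ))
  | .inr ⟨j, l, i⟩ => refineOrder (scale j) (finalWidth N ε j * (4 / 3) ^ ((l : ℕ) + 1)) i

/-- The number of flips of a coin, where the failure probability is about `exp (-T)`. -/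
def coinFlips (N ε : ℝ) (n T : ℕ) : CoinIndex N ε n → ℕ
  | .inl j => 65536 * T * ((j.rev : ℕ) + 1)
  | .inr ⟨_, l, _⟩ => 65536 * T * ((l : ℕ) + 1)

lemma coinFlips_pos {N ε : ℝ} {n T : ℕ} (hT : 0 < T) (i : CoinIndex N ε n) :
    0 < coinFlips N ε n T i := by
  rcases i with j | ⟨j, l, i⟩ <;> rw [coinFlips] <;> positivity

lemma sum_scale_cost_le (n : ℕ) :
    ∑ j : Fin n, (((j.rev : ℕ) : ℝ) + 1) * (2 ^ (7 + (j : ℕ)) + 1) ≤ 16 * 2 ^ (n + 7) := by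
  have h1 : ∀ j : Fin n, (((j.rev : ℕ) : ℝ) + 1) * (2 ^ (7 + (j : ℕ)) + 1) ≤
      2 ^ (n + 7) * ((((j.rev : ℕ) : ℝ) + 1) * (3 / 4) ^ (j.rev : ℕ)) := by
    intro j
    have hn : n + 7 = (7 + (j : ℕ)) + 1 + (j.rev : ℕ) := by rw [Fin.val_rev]; omega
    have h2 : (1 : ℝ) ≤ 2 ^ (7 + (j : ℕ)) := one_le_pow₀ one_le_two
    -- The ratio `1/2` is weakened to `3/4` so that `sum_succ_mul_pow_le` serves here as well.
    have h3 : (1 : ℝ) ≤ 2 ^ (j.rev : ℕ) * (3 / 4) ^ (j.rev : ℕ) := by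
      rw [← mul_pow]; exact one_le_pow₀ (by norm_num)
    have h4 : (2 : ℝ) ^ (7 + (j : ℕ)) + 1 ≤ 2 ^ (n + 7) * (3 / 4) ^ (j.rev : ℕ) := by
      rw [hn, pow_add _ _ (j.rev : ℕ), mul_assoc, pow_succ]
      nlinarith
    calc _ ≤ (((j.rev : ℕ) : ℝ) + 1) * (2 ^ (n + 7) * (3 / 4) ^ (j.rev : ℕ)) := by gcongr
      _ = _ := by ring
  calc _ ≤ ∑ j : Fin n, 2 ^ (n + 7) * ((((j.rev : ℕ) : ℝ) + 1) * (3 / 4) ^ (j.rev : ℕ)) :=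
        Finset.sum_le_sum fun j _ => h1 j
    _ = 2 ^ (n + 7) * ∑ j : Fin n, (((j : ℕ) : ℝ) + 1) * (3 / 4) ^ (j : ℕ) := by
        rw [← Finset.mul_sum]
        congr 1
        exact Equiv.sum_comp Fin.revPerm fun j : Fin n => (((j : ℕ) : ℝ) + 1) * (3 / 4) ^ (j : ℕ)
    _ ≤ 2 ^ (n + 7) * 16 := by gcongr; exact sum_succ_mul_pow_le n
    _ = _ := mul_comm _ _

lemma coin_cost_le {N ε : ℝ} (hN : 0 < N) (hε : 0 < ε) (n T : ℕ) :
    ((∑ i, coinFlips N ε n T i * (coinOrder N ε n i + 1) : ℕ) : ℝ) ≤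
      65536 * T * ((∑ j : Fin n, (((j.rev : ℕ) : ℝ) + 1) * (2 ^ (7 + (j : ℕ)) + 1)) +
        2293760 * Real.sqrt (N / ε)) := by
  rw [Fintype.sum_sum_type, Fintype.sum_sigma]
  push_cast
  rw [mul_add]
  refine add_le_add (le_of_eq ?_) ?_
  · rw [Finset.mul_sum]
    refine Finset.sum_congr rfl fun j _ => ?_
    simp only [coinFlips, coinOrder]
    push_cast
    ring
  · have h1 : ∀ j : Fin n, ∑ x : Fin (depth N ε j) × Fin 320,
        (coinFlips N ε n T (.inr ⟨j, x⟩) : ℝ) * ((coinOrder N ε n (.inr ⟨j, x⟩) : ℝ) + 1) ≤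
        65536 * T * (8192 * (precision N ε j)⁻¹) := by
      intro j
      have hρ := precision_pos (N := N) hε j
      rw [Fintype.sum_prod_type]
      calc _ ≤ ∑ l : Fin (depth N ε j), ∑ _i : Fin 320, 65536 * (T : ℝ) *
            (8 / 5 * (precision N ε j)⁻¹) * ((((l : ℕ) : ℝ) + 1) * (3 / 4) ^ (l : ℕ)) := by
            refine Finset.sum_le_sum fun l _ => Finset.sum_le_sum fun i _ => ?_
            simp only [coinFlips, coinOrder]
            push_cast
            calc _ ≤ 65536 * (T : ℝ) * (((l : ℕ) : ℝ) + 1) *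
                  (8 / 5 * (precision N ε j)⁻¹ * (3 / 4) ^ (l : ℕ)) := by
                  gcongr; exact refineOrder_cost hε l.2 i
              _ = _ := by ring
        _ = 65536 * (T : ℝ) * (512 * (precision N ε j)⁻¹) *
            ∑ l : Fin (depth N ε j), (((l : ℕ) : ℝ) + 1) * (3 / 4) ^ (l : ℕ) := by
            simp only [Finset.sum_const, Finset.card_univ, Fintype.card_fin, nsmul_eq_mul,
              ← Finset.mul_sum]
            push_cast
            ring
        _ ≤ 65536 * (T : ℝ) * (512 * (precision N ε j)⁻¹) * 16 := by
            gcongr; exact sum_succ_mul_pow_le _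
        _ = _ := by ring
    calc _ ≤ ∑ j : Fin n, 65536 * (T : ℝ) * (8192 * (precision N ε j)⁻¹) :=
          Finset.sum_le_sum fun j _ => h1 j
      _ = 65536 * (T : ℝ) * (8192 * ∑ j : Fin n, (precision N ε j)⁻¹) := by
          rw [← Finset.mul_sum, ← Finset.mul_sum]
      _ ≤ 65536 * (T : ℝ) * (8192 * (280 * Real.sqrt (N / ε))) := by
          gcongr; exact sum_inv_precision_le hN hε n
      _ = _ := by ring

/-- The scales compatible with an angle. -/
def matchingScales (n : ℕ) (θ : ℝ) : Finset (Fin n) :=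
  Finset.univ.filter fun j => 1 / 4 ≤ scale j * θ ∧ scale j * θ ≤ 3 / 2

/-- Matching scales differ by a factor of at most `6`, whereas three doublings give at least `7`.
This keeps the union bound over refinement coins independent of `n`. -/
lemma card_matchingScales_le (n : ℕ) (θ : ℝ) : (matchingScales n θ).card ≤ 3 := by
  have hclose : ∀ j ∈ matchingScales n θ, ∀ k ∈ matchingScales n θ, (k : ℕ) < j + 3 := by
    intro j hj k hk
    rw [matchingScales, Finset.mem_filter] at hj hk
    by_contra hcon
    push Not at hcon
    have h1 : (2 : ℝ) ^ (8 + (j : ℕ)) * 8 ≤ 2 ^ (8 + (k : ℕ)) := by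
      calc (2 : ℝ) ^ (8 + (j : ℕ)) * 8 = 2 ^ (8 + (j : ℕ) + 3) := by rw [pow_add _ _ 3]; norm_num
        _ ≤ _ := pow_le_pow_right₀ one_le_two (by omega)
    have hθ : 0 < θ := by
      by_contra hneg
      push Not at hneg
      nlinarith [scale_pos j, hj.2.1]
    have h2 := le_scale j
    have h3 : 7 * scale j ≤ scale k := by
      unfold scale at h2 ⊢; linarith
    nlinarith [hj.2.1, hk.2.2]
  rcases (matchingScales n θ).eq_empty_or_nonempty with h0 | hne
  · simp [h0]
  · obtain ⟨j, hj, hmin⟩ := Finset.exists_min_image _ (fun j : Fin n => (j : ℕ)) hne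
    calc (matchingScales n θ).card = ((matchingScales n θ).map Fin.valEmbedding).card :=
          (Finset.card_map _).symm
      _ ≤ (Finset.Ico (j : ℕ) (j + 3)).card := by
          refine Finset.card_le_card fun k hk => ?_
          obtain ⟨k', hk', rfl⟩ := Finset.mem_map.mp hk
          exact Finset.mem_Ico.mpr ⟨hmin k' hk', hclose j hj k' hk'⟩
      _ = 3 := by simp

/-- The coins that matter for an angle. -/
def relevantCoins (N ε : ℝ) (n : ℕ) (θ : ℝ) : Finset (CoinIndex N ε n) :=
  Finset.univ.disjSum ((matchingScales n θ).sigma fun _ => Finset.univ)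

lemma sum_relevantCoins_le {N ε : ℝ} {n T : ℕ} (hT : 0 < T) (θ : ℝ) :
    ∑ i ∈ relevantCoins N ε n θ, 2 * Real.exp (-(coinFlips N ε n T i * ((1 / 32) ^ 2 / 4))) ≤
      Real.exp (-T) := by
  have hT1 : (1 : ℝ) ≤ T := by exact_mod_cast hT
  set x := Real.exp (-(16 * T)) with hx
  have hx0 : 0 < x := Real.exp_pos _
  -- `65536/4096 = 16`. The total will be `(4 + 3 · 1280) x < 2^15 x`, absorbed by `exp (15 - 16T) ≤
  -- exp (-T)`.
  have hpow : ∀ k : ℕ, Real.exp (-(65536 * T * ((k : ℝ) + 1) * ((1 / 32) ^ 2 / 4)))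
      = x ^ (k + 1) := by
    intro k
    rw [hx, ← Real.exp_nat_mul]
    congr 1
    push_cast
    ring
  have hxT : 2 ^ 15 * x ≤ Real.exp (-T) := by
    have h2 : (2 : ℝ) ≤ Real.exp 1 := by linarith [Real.add_one_le_exp (1 : ℝ)]
    have h3 : (2 : ℝ) ^ 15 ≤ Real.exp 15 := by
      calc (2 : ℝ) ^ 15 ≤ Real.exp 1 ^ 15 := by gcongr
        _ = Real.exp 15 := by rw [← Real.exp_nat_mul]; norm_num
    calc 2 ^ 15 * x ≤ Real.exp 15 * x := by gcongr
      _ = Real.exp (15 - 16 * T) := by rw [hx, ← Real.exp_add]; ring_nf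
      _ ≤ _ := Real.exp_le_exp.mpr (by linarith)
  have hx1 : x ≤ 1 / 2 := by
    have : Real.exp (-(T : ℝ)) ≤ 1 := Real.exp_le_one_iff.mpr (by linarith)
    linarith
  rw [relevantCoins, Finset.sum_disjSum, Finset.sum_sigma]
  have hA : ∑ j : Fin n, 2 * Real.exp (-((coinFlips N ε n T (.inl j) : ℝ) * ((1 / 32) ^ 2 / 4))) ≤
      4 * x := by
    calc _ = 2 * ∑ j : Fin n, x ^ ((j.rev : ℕ) + 1) := by
          rw [Finset.mul_sum]
          refine Finset.sum_congr rfl fun j _ => ?_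
          rw [← hpow, coinFlips]
          push_cast
          rfl
      _ = 2 * ∑ j : Fin n, x ^ ((j : ℕ) + 1) := by
          congr 1
          exact Equiv.sum_comp Fin.revPerm fun j : Fin n => x ^ ((j : ℕ) + 1)
      _ ≤ 2 * (2 * x) := by gcongr; exact sum_pow_succ_le hx0.le hx1 n
      _ = _ := by ring
  have hB : ∀ j : Fin n, ∑ y : Fin (depth N ε j) × Fin 320,
      2 * Real.exp (-((coinFlips N ε n T (.inr ⟨j, y⟩) : ℝ) * ((1 / 32) ^ 2 / 4))) ≤ 1280 * x := by
    intro j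
    rw [Fintype.sum_prod_type]
    calc _ = ∑ l : Fin (depth N ε j), ∑ _i : Fin 320, 2 * x ^ ((l : ℕ) + 1) := by
          refine Finset.sum_congr rfl fun l _ => Finset.sum_congr rfl fun i _ => ?_
          rw [← hpow, coinFlips]
          push_cast
          rfl
      _ = 640 * ∑ l : Fin (depth N ε j), x ^ ((l : ℕ) + 1) := by
          simp only [Finset.sum_const, Finset.card_univ, Fintype.card_fin, nsmul_eq_mul,
            ← Finset.mul_sum]
          push_cast
          ring
      _ ≤ 640 * (2 * x) := by gcongr; exact sum_pow_succ_le hx0.le hx1 _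
      _ = _ := by ring
  have hC : ∑ j ∈ matchingScales n θ, ∑ y : Fin (depth N ε j) × Fin 320,
      2 * Real.exp (-((coinFlips N ε n T (.inr ⟨j, y⟩) : ℝ) * ((1 / 32) ^ 2 / 4))) ≤ 3840 * x := by
    have hcard : ((matchingScales n θ).card : ℝ) ≤ 3 := by
      exact_mod_cast card_matchingScales_le n θ
    calc _ ≤ ∑ _j ∈ matchingScales n θ, 1280 * x := Finset.sum_le_sum fun j _ => hB j
      _ = (matchingScales n θ).card * (1280 * x) := by rw [Finset.sum_const, nsmul_eq_mul]
      _ ≤ 3 * (1280 * x) := by gcongr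
      _ = _ := by ring
  linarith

/-- The post-processing: a scan for the scale, followed by a refinement. -/
lemma exists_decisionTree {N ε : ℝ} (hN : 0 < N) (hε : 0 < ε) (hε1 : ε ≤ 1) (n : ℕ) :
    ∃ P : PostProcessing (Fintype.card (CoinIndex N ε n)), (P.steps : ℝ) ≤ n + 1125 / ε ∧
      ∀ (θ : ℝ) (K : ℕ) (p : Fin (Fintype.card (CoinIndex N ε n)) → ℝ), 1 ≤ K →
        N * Real.sin θ ^ 2 = K → 0 ≤ θ → 257 * θ ≤ 3 / 2 → 3 / 2 < scale n * θ →
        (∀ i ∈ relevantCoins N ε n θ, |p (Fintype.equivFin _ i) -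
          Real.sin ((2 * coinOrder N ε n i + 1) * θ) ^ 2| < 1 / 32) →
        Approx ε (P.run p) K := by
  have hQ : ∀ j : Fin n, ∃ Q : PostProcessing (Fintype.card (CoinIndex N ε n)),
      Q.steps ≤ depth N ε j ∧
      ∀ (θ : ℝ) (p : Fin (Fintype.card (CoinIndex N ε n)) → ℝ), 1 / (4 * scale j) ≤ θ →
        θ ≤ 3 / (2 * scale j) →
        (∀ l i, |p (Fintype.equivFin (CoinIndex N ε n) (.inr ⟨j, l, i⟩)) -
          Real.sin ((2 * coinOrder N ε n (.inr ⟨j, l, i⟩) + 1) * θ) ^ 2| < 1 / 32) →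
        ∃ c, |c - θ| ≤ precision N ε j ∧ 1 / (4 * scale j) ≤ c ∧ c ≤ 3 / (2 * scale j) ∧
          Q.run p = leafOutput N ε (scale j) c := by
    intro j
    have hs := scale_pos j
    have hend : 1 / (4 * scale j) + finalWidth N ε j * (4 / 3) ^ depth N ε j
        = 3 / (2 * scale j) := by
      rw [finalWidth_mul]; field_simp; norm_num
    obtain ⟨Q, hQ, hQ'⟩ := exists_refineTree (le_scale j) (finalWidth_pos N ε j)
      (leafOutput N ε (scale j)) (depth N ε j)
      (fun l i => Fintype.equivFin (CoinIndex N ε n) (.inr ⟨j, l, i⟩)) (1 / (4 * scale j)) le_rfl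
      hend.le
    refine ⟨Q, hQ, fun θ p h1 h2 h3 => ?_⟩
    obtain ⟨c, hc, hc'⟩ := hQ' θ p h1 (by rwa [hend]) h3
    exact ⟨c, hc.trans (finalWidth_le_precision hε j), hc'⟩
  choose Q hQ hQ' using hQ
  obtain ⟨P, hP, hP'⟩ := exists_scanTree (B := ⌊1125 / ε⌋₊) n 8
    (fun j => Fintype.equivFin (CoinIndex N ε n) (.inl j)) Q
    fun j => (hQ j).trans (Nat.le_floor (depth_le hε j))
  refine ⟨P, ?_, fun θ K p hK hθK h0 h1 h2 hgood => ?_⟩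
  · calc (P.steps : ℝ) ≤ ((n + ⌊1125 / ε⌋₊ : ℕ) : ℝ) := by exact_mod_cast hP
      _ ≤ _ := by
        push_cast
        gcongr
        exact Nat.floor_le (by positivity)
  · obtain ⟨j, hj1, hj2, hj3⟩ := hP' θ p h0 (by linarith) h2 fun j => by
      have := hgood (.inl j) (by simp [relevantCoins])
      rw [coinOrder] at this
      push_cast at this
      rwa [← pow_succ', show 7 + (j : ℕ) + 1 = 8 + j by ring] at this
    have hs := scale_pos j
    have hθ1 : 1 / (4 * scale j) ≤ θ := by
      rw [div_le_iff₀ (by positivity)]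
      change _ ≤ scale j * θ at hj1
      linarith
    have hθ2 : θ ≤ 3 / (2 * scale j) := by
      rw [le_div_iff₀ (by positivity)]
      change scale j * θ ≤ _ at hj2
      linarith
    obtain ⟨c, hc, hc1, hc2, hrun⟩ := hQ' j θ p hθ1 hθ2 fun l i => hgood _ (by
      simp only [relevantCoins, Finset.inr_mem_disjSum, Finset.mem_sigma, Finset.mem_univ,
        and_true, matchingScales, Finset.mem_filter, true_and]
      exact ⟨hj1, hj2⟩)
    rw [hj3, hrun]
    exact approx_leafOutput hN hε hε1 (by linarith [le_scale j]) hK hθK hθ1 hθ2 hc1 hc2 hc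

theorem exists_nonadaptive_algorithm {N : ℕ} {ε δ : ℝ} (hN : 1 ≤ N) (hε : 0 < ε) (hε1 : ε ≤ 1)
    (hδ : 0 < δ) (hδ1 : δ ≤ 1 / 2) :
    ∃ (S : GroverSchedule) (P : PostProcessing S.m),
      (S.queries : ℝ) ≤ 10 ^ 12 * Real.sqrt (N / ε) * Real.log (1 / δ) ∧
      (P.steps : ℝ) ≤ 1125 * (Real.log N + 1 / ε) ∧
      ∀ f : Fin N → Bool, 1 ≤ numMarked f → 2 ^ 20 * numMarked f ≤ N →
        1 - δ ≤ S.successProb P.run ε f := by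
  have hN0 : (0 : ℝ) < N := by exact_mod_cast hN
  -- Chosen so that `scale n` exceeds `2√N` when `N ≥ 4^6`; as `θ ≥ 1/√N`, the scan then always
  -- stops. For smaller `N` the subtraction may truncate, but no `f` satisfies `1 ≤ K ≤ 2^{-20} N`.
  set n := Nat.log 4 N - 6 with hn
  have hlogδ : Real.log 2 ≤ Real.log (1 / δ) := by
    apply Real.log_le_log two_pos
    rw [le_div_iff₀ hδ]; linarith
  have hlog2 := Real.log_two_gt_d9
  set T := ⌈Real.log (1 / δ)⌉₊ with hT
  have hT0 : 0 < T := Nat.ceil_pos.mpr (by linarith)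
  have hT1 : Real.log (1 / δ) ≤ T := Nat.le_ceil _
  have hT2 : (T : ℝ) ≤ 5 / 2 * Real.log (1 / δ) := by
    have := Nat.ceil_lt_add_one (show 0 ≤ Real.log (1 / δ) by linarith)
    linarith
  have hlogN : (4 : ℝ) ^ Nat.log 4 N ≤ N := by exact_mod_cast Nat.pow_log_le_self 4 (by omega)
  obtain ⟨P, hP, hP'⟩ := exists_decisionTree hN0 hε hε1 n
  refine ⟨coinSchedule (coinOrder N ε n) (coinFlips N ε n T) (coinFlips_pos hT0), P, ?_, ?_, ?_⟩
  · rw [coinSchedule_queries]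
    refine (coin_cost_le hN0 hε n T).trans ?_
    have h1 : ∑ j : Fin n, (((j.rev : ℕ) : ℝ) + 1) * (2 ^ (7 + (j : ℕ)) + 1) ≤
        32 * Real.sqrt (N / ε) := by
      rcases Nat.eq_zero_or_pos n with h0 | hpos
      · have : ∑ j : Fin n, (((j.rev : ℕ) : ℝ) + 1) * (2 ^ (7 + (j : ℕ)) + 1) = 0 := by
          apply Finset.sum_eq_zero
          intro j _
          exact absurd j.2 (by omega)
        rw [this]; positivity
      · refine (sum_scale_cost_le n).trans ?_
        have h2 : (2 : ℝ) ^ Nat.log 4 N ≤ Real.sqrt N := by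
          apply Real.le_sqrt_of_sq_le
          rw [← pow_mul, mul_comm, pow_mul]
          norm_num
          exact hlogN
        have h3 : Real.sqrt N ≤ Real.sqrt (N / ε) := by
          apply Real.sqrt_le_sqrt
          rw [le_div_iff₀ hε]
          nlinarith
        rw [show n + 7 = Nat.log 4 N + 1 by omega, pow_succ]
        linarith
    have hℓ : 0 ≤ Real.log (1 / δ) := by linarith
    calc _ ≤ 65536 * (5 / 2 * Real.log (1 / δ)) * (32 * Real.sqrt (N / ε) +
          2293760 * Real.sqrt (N / ε)) := by gcongr
      _ = 375814881280 * (Real.sqrt (N / ε) * Real.log (1 / δ)) := by ring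
      _ ≤ 10 ^ 12 * (Real.sqrt (N / ε) * Real.log (1 / δ)) := by
        gcongr
        norm_num
      _ = _ := by ring
  · have h1 : (Nat.log 4 N : ℝ) ≤ Real.log N := by
      have h2 := Real.log_le_log (by positivity) hlogN
      rw [Real.log_pow, show (4 : ℝ) = 2 ^ 2 by norm_num, Real.log_pow] at h2
      push_cast at h2
      nlinarith [Nat.cast_nonneg (α := ℝ) (Nat.log 4 N)]
    have h2 : (n : ℝ) ≤ Nat.log 4 N := by exact_mod_cast Nat.sub_le _ _
    have h3 : 0 ≤ Real.log N := Real.log_natCast_nonneg N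
    rw [mul_add, mul_one_div]
    exact hP.trans (by linarith)
  · intro f hK hKN
    have hsum := sum_relevantCoins_le (N := N) (ε := ε) (n := n) hT0 (groverAngle f)
    have hδT : Real.exp (-(T : ℝ)) ≤ δ := by
      calc Real.exp (-(T : ℝ)) ≤ Real.exp (-Real.log (1 / δ)) := Real.exp_le_exp.mpr (by linarith)
        _ = δ := by rw [← Real.log_inv, Real.exp_log (by positivity)]; simp
    refine le_trans (by linarith) (coinSchedule_successProb (coinOrder N ε n) (coinFlips N ε n T)
      (coinFlips_pos hT0) P.run (η := 1 / 32) (by norm_num) (by norm_num) f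
      (relevantCoins N ε n (groverAngle f)) fun p hp => ?_)
    have hK0 : (1 : ℝ) ≤ numMarked f := by exact_mod_cast hK
    have hKN' : (2 : ℝ) ^ 20 * numMarked f ≤ N := by exact_mod_cast hKN
    have hsin := sin_groverAngle f
    have hθ0 := groverAngle_nonneg f
    have hsin_le : Real.sin (groverAngle f) ≤ 1 / 2 ^ 10 := by
      rw [hsin]
      apply Real.sqrt_le_iff.mpr
      refine ⟨by positivity, ?_⟩
      rw [div_le_iff₀ hN0]
      linarith
    have hpi2 := Real.pi_lt_d2
    refine hP' (groverAngle f) (numMarked f) p hK ?_ hθ0 ?_ ?_ hp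
    · rw [hsin, Real.sq_sqrt (by positivity)]
      field_simp
    -- The only use of the small density of marked inputs beyond forcing `N` to be large: the scan
    -- has to start with phase at most `3/2`.
    · have h1 := Real.mul_le_sin hθ0 (groverAngle_le_pi_div_two f)
      have h2 : 63 / 100 ≤ 2 / Real.pi := by
        rw [le_div_iff₀ Real.pi_pos]; linarith
      nlinarith
    · have h10 : 10 ≤ Nat.log 4 N := by
        apply Nat.le_log_of_pow_le (by norm_num)
        omega
      have h1 : (N : ℝ) < 4 ^ (Nat.log 4 N + 1) := by
        exact_mod_cast Nat.lt_pow_succ_log_self (by norm_num) N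
      have h2 : Real.sqrt N < 2 ^ (Nat.log 4 N + 1) := by
        rw [Real.sqrt_lt' (by positivity), ← pow_mul, mul_comm, pow_mul]
        norm_num
        exact h1
      have h3 : 1 ≤ Real.sqrt N * groverAngle f := by
        have h4 := Real.sin_le hθ0
        have h5 : 1 ≤ Real.sqrt N * Real.sin (groverAngle f) := by
          rw [hsin, ← Real.sqrt_mul hN0.le, mul_div_cancel₀ _ hN0.ne']
          exact Real.one_le_sqrt.mpr hK0
        exact h5.trans (by gcongr)
      rw [scale, show 8 + n = Nat.log 4 N + 1 + 1 by omega, pow_succ]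
      nlinarith

end NonadaptiveGrover

end

theorem theorem1 :
    -- the algorithm on `f` itself, for `K ≤ 2^{-20} N`
    (∃ C : ℝ, 0 < C ∧ ∀ (N : ℕ) (ε δ : ℝ), 1 ≤ N → 1 / (N : ℝ) ≤ ε → ε ≤ 1 → 0 < δ → δ ≤ 1 / 2 →
      ∃ (S : GroverSchedule) (P : PostProcessing S.m),
        (S.queries : ℝ) ≤ C * Real.sqrt (N / ε) * Real.log (1 / δ) ∧
        (P.steps : ℝ) ≤ C * (Real.log N + 1 / ε) ∧
        ∀ f : Fin N → Bool, 1 ≤ numMarked f → 2 ^ 20 * numMarked f ≤ N →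
          1 - δ ≤ S.successProb P.run ε f) ∧
    -- the algorithm on `f` extended by zero to a domain of size `2^20 N`, for `K ≤ N / 2`
    (∃ C : ℝ, 0 < C ∧ ∀ (N : ℕ) (ε δ : ℝ), 1 ≤ N → 1 / (N : ℝ) ≤ ε → ε ≤ 1 → 0 < δ → δ ≤ 1 / 2 →
      ∃ (S : GroverSchedule) (P : PostProcessing S.m),
        (S.queries : ℝ) ≤ C * Real.sqrt (N / ε) * Real.log (1 / δ) ∧
        (P.steps : ℝ) ≤ C * (Real.log N + 1 / ε) ∧
        ∀ f : Fin N → Bool, 1 ≤ numMarked f → 2 * numMarked f ≤ N →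
          1 - δ ≤ S.successProb P.run ε (pad (2 ^ 20 * N) f)) ∧
    -- tightness: a lower bound for every schedule and every (randomized) post-processing
    (∃ (c : ℝ) (N₀ : ℕ), 0 < c ∧ ∀ (N M : ℕ) (ε : ℝ), N₀ ≤ N → N ≤ M → 1 / (N : ℝ) ≤ ε → ε ≤ 1 →
      ∀ (S : GroverSchedule) (g : (Fin S.m → ℝ) → ProbabilityMeasure ℝ),
        (∀ f : Fin N → Bool, 1 ≤ numMarked f → 2 ^ 20 * numMarked f ≤ N →
          2 / 3 ≤ S.successProbRand g ε (pad M f)) →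
        c * Real.sqrt (N / ε) ≤ (S.queries : ℝ)) := by
  refine ⟨⟨10 ^ 12, by norm_num, fun N ε δ hN hε hε1 hδ hδ1 => ?_⟩,
    ⟨10 ^ 16, by norm_num, fun N ε δ hN hε hε1 hδ hδ1 => ?_⟩,
    ⟨1 / 1000000, 2 ^ 24, by norm_num, fun N M ε hN hNM hε hε1 S g h =>
      queries_lower_bound hN hNM hε hε1 S g h⟩⟩
  · have hN0 : (0 : ℝ) < N := by exact_mod_cast hN
    have hε0 : 0 < ε := lt_of_lt_of_le (by positivity) hε
    obtain ⟨S, P, hq, hs, hf⟩ := exists_nonadaptive_algorithm hN hε0 hε1 hδ hδ1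
    refine ⟨S, P, hq, hs.trans ?_, hf⟩
    have := Real.log_natCast_nonneg N
    gcongr
    norm_num
  · have hN0 : (0 : ℝ) < N := by exact_mod_cast hN
    have hε0 : 0 < ε := lt_of_lt_of_le (by positivity) hε
    -- Padding makes the density of marked inputs small and multiplies the query bound by only
    -- `2^10`.
    obtain ⟨S, P, hq, hs, hf⟩ := exists_nonadaptive_algorithm (N := 2 ^ 20 * N) (by omega)
      hε0 hε1 hδ hδ1
    have hℓ : 0 ≤ Real.log (1 / δ) := by
      apply Real.log_nonneg
      rw [le_div_iff₀ hδ]; linarith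
    refine ⟨S, P, hq.trans ?_, hs.trans ?_, fun f hK hKN => ?_⟩
    · have h1 : Real.sqrt (((2 ^ 20 * N : ℕ) : ℝ) / ε) = 2 ^ 10 * Real.sqrt (N / ε) := by
        rw [show ((2 ^ 20 * N : ℕ) : ℝ) / ε = (2 ^ 10) ^ 2 * (N / ε) by push_cast; ring,
          Real.sqrt_mul (by positivity), Real.sqrt_sq (by positivity)]
      rw [h1, ← mul_assoc]
      gcongr
      norm_num
    · have h1 : Real.log ((2 ^ 20 * N : ℕ) : ℝ) ≤ 20 + Real.log N := by
        push_cast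
        rw [Real.log_mul (by positivity) hN0.ne', show (1048576 : ℝ) = 2 ^ 20 by norm_num, Real.log_pow]
        push_cast
        linarith [Real.log_two_lt_d9]
      have h2 : 1 ≤ 1 / ε := by rwa [le_div_iff₀ hε0, one_mul]
      have h3 := Real.log_natCast_nonneg N
      calc _ ≤ 1125 * ((20 + Real.log N) + 1 / ε) := by gcongr
        _ ≤ _ := by linarith
    · have hpad := numMarked_pad (show N ≤ 2 ^ 20 * N by omega) f
      exact hf _ (by omega) (by rw [hpad]; omega)
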